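/- Write $\mathbb H=\{z\in\mathbb C:\operatorname{Im}z>0\}$ and, for $L>0$, $R_L=\{x+iy: 0<x<L,\ 0<y<\pi\}$. A conformal map of $R_L$ onto $\mathbb H$ is a holomorphic bijection $R_L\to\mathbb H$; its values at boundary points (in $\overline{\mathbb R}=\mathbb R\cup\{\infty\}$) are understood as limits from within $R_L$. (a) For every $L>0$ there is a unique conformal map $\Phi_L$ of $R_L$ onto $\mathbb H$ with $\Phi_L(i\pi)=0$, $\Phi_L(0)=1$ and $\Phi_L(L+i\pi)=\infty$, and a unique conformal map $\Psi_L$ of $R_L$ onto $\mathbb H$ with $\Psi_L(0)=1$, $\Psi_L(L)=\infty$ and $\Psi_L(L+i\pi)=0$. (b) $\Phi_L$ maps $L$ onto some point $\rho=\rho(L)>1$ of the real line. The length $L$ is a strictly increasing function of $\rho\in(1,\infty)$ (that is, $L\mapsto\rho(L)$ is a bijection of $(0,\infty)$ onto $(1,\infty)$ with strictly increasing inverse), and $$L=\log\rho+O(1)\qquad\text{as }L\to\infty .$$ (c) $\Psi_L$ maps $i\pi$ onto some point $\xi=\xi(L)\in(0,1)$, and $$L=-\log(1-\xi)+O(1)\qquad\text{as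 }L\to\infty .$$ -/

import Mathlib

open Real Set Filter Topology Asymptotics

/-- The open rectangle `(0, L) × (0, iπ)` in the complex plane. -/
def openRect (L : ℝ) : Set ℂ := Ioo 0 L ×ℂ Ioo 0 π

/-- `f` is a conformal map of the domain `D` onto the domain `D'`:
it is holomorphic on `D` and maps `D` bijectively onto `D'`. -/
def IsConformalOnto (f : ℂ → ℂ) (D D' : Set ℂ) : Prop :=
  DifferentiableOn ℂ f D ∧ BijOn f D D'

/-- The map `f` on `D` sends the boundary point `a` of `D` to the finite point `b`,
in the sense of boundary limits taken from within `D`. -/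
def SendsTo (f : ℂ → ℂ) (D : Set ℂ) (a b : ℂ) : Prop :=
  Tendsto f (𝓝[D] a) (𝓝 b)

/-- The map `f` on `D` sends the boundary point `a` of `D` to `∞`:
`|f z| → ∞` as `z → a` within `D`. -/
def SendsToInfty (f : ℂ → ℂ) (D : Set ℂ) (a : ℂ) : Prop :=
  Tendsto f (𝓝[D] a) (Bornology.cobounded ℂ)

/-- `Φ` is a conformal map of `(0, L) × (0, iπ)` onto the upper half-plane with
`Φ(iπ) = 0`, `Φ(0) = 1` and `Φ(L + iπ) = ∞`. Only the values of `Φ` on the open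
rectangle matter. -/
structure IsRectMapPhi (L : ℝ) (Φ : ℂ → ℂ) : Prop where
  conformal : IsConformalOnto Φ (openRect L) UpperHalfPlane.upperHalfPlaneSet
  at_top_left : SendsTo Φ (openRect L) (π * Complex.I) 0
  at_bottom_left : SendsTo Φ (openRect L) 0 1
  at_top_right : SendsToInfty Φ (openRect L) (L + π * Complex.I)

/-- `Ψ` is a conformal map of `(0, L) × (0, iπ)` onto the upper half-plane with
`Ψ(0) = 1`, `Ψ(L) = ∞` and `Ψ(L + iπ) = 0`. Only the values of `Ψ` on the open
rectangle matter. -/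
structure IsRectMapPsi (L : ℝ) (Ψ : ℂ → ℂ) : Prop where
  conformal : IsConformalOnto Ψ (openRect L) UpperHalfPlane.upperHalfPlaneSet
  at_bottom_left : SendsTo Ψ (openRect L) 0 1
  at_bottom_right : SendsToInfty Ψ (openRect L) L
  at_top_right : SendsTo Ψ (openRect L) (L + π * Complex.I) 0

/-! Put q = e^{-L}. The exponential w = e^z carries the rectangle onto the upper half of the annulus
1 < |w| < 1/q, and there the conformal map is an explicit elliptic function in multiplicative
notation. Writing θ for the theta product with base q², the quotient `thetaQuot` is θ(-w)²/(w
θ(-qw)²). It is invariant under w ↦ q²w and w ↦ 1/w and commutes with conjugation; each side of the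
rectangle is fixed by a reflection built from these symmetries, so the function is real on the
boundary (`rectMap_im_eq_zero`).

Weierstrass' identity `thetaProd_three_term`, itself a consequence of Liouville's theorem, makes the
difference of the values at w and a a multiple of θ(wa)θ(w/a). Since the zeros of θ are exactly the
powers of q², the function is injective on the half annulus (`thetaQuot_injOn`) and never real there
(`thetaQuot_conj_ne`). Its image is open and relatively closed in the half-plane, hence everything
(`isConformalOnto_upperHalfPlane`). Uniqueness is the equality case of the Schwarz lemma
(`eqOn_of_isConformalOnto`).

The image of the corner L is ρ = θ(-q)⁴/(q θ(-1)⁴). Jacobi's quartic identity turns this into 1 +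
r(q)⁸/(16q), where r = `nomeRatio` is a quotient of products with factorwise monotone terms. So ρ is
strictly decreasing in q, and ρq → 1/16 as q → 0, which gives L - log ρ → log 16.

The second normalization follows from the first by the Möbius map w ↦ (ρ - 1)/(ρ - w), which fixes 1
and sends ρ to ∞ and ∞ to 0. It sends 0 to ξ = 1 - 1/ρ, so -log(1 - ξ) = log ρ and both asymptotics
coincide. -/

/-! ### Injective holomorphic maps and their inverses -/

lemma Set.InjOn.not_eventually_const {D : Set ℂ} {F : ℂ → ℂ} (hD : IsOpen D) (hinj : InjOn F D)
    {z : ℂ} (hz : z ∈ D) : ¬ ∀ᶠ x in 𝓝 z, F x = F z := by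
  intro h
  have h2 : ∀ᶠ x in 𝓝[≠] z, x = z := by
    filter_upwards [nhdsWithin_le_nhds h, nhdsWithin_le_nhds (hD.mem_nhds hz)] with x hx hxD
    exact hinj hxD hz hx
  obtain ⟨x, hx, hne⟩ := (h2.and self_mem_nhdsWithin).exists
  exact hne hx

lemma nhds_le_map_nhds_of_injOn {D : Set ℂ} {F : ℂ → ℂ} (hD : IsOpen D)
    (hF : DifferentiableOn ℂ F D) (hinj : InjOn F D) {z : ℂ} (hz : z ∈ D) :
    𝓝 (F z) ≤ map F (𝓝 z) :=
  ((hF.analyticAt (hD.mem_nhds hz)).eventually_constant_or_nhds_le_map_nhds).resolve_left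
    (hinj.not_eventually_const hD hz)

lemma isOpen_image_of_injOn {D : Set ℂ} {F : ℂ → ℂ} (hD : IsOpen D)
    (hF : DifferentiableOn ℂ F D) (hinj : InjOn F D) : IsOpen (F '' D) := by
  rw [isOpen_iff_mem_nhds]
  rintro _ ⟨z, hz, rfl⟩
  exact nhds_le_map_nhds_of_injOn hD hF hinj hz (image_mem_map (hD.mem_nhds hz))

/-- A left inverse of an injective holomorphic map is holomorphic on the image. -/
lemma differentiableOn_leftInverse {D : Set ℂ} {F G : ℂ → ℂ} (hD : IsOpen D)
    (hF : DifferentiableOn ℂ F D) (hinv : ∀ z ∈ D, G (F z) = z) :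
    DifferentiableOn ℂ G (F '' D) := by
  have hinj : InjOn F D := fun x hx y hy h => by rw [← hinv x hx, ← hinv y hy, h]
  have hopen := isOpen_image_of_injOn hD hF hinj
  have hcont : ∀ z ∈ D, ContinuousAt G (F z) := by
    intro z hz
    unfold ContinuousAt
    rw [hinv z hz]
    refine Tendsto.mono_left ?_ (nhds_le_map_nhds_of_injOn hD hF hinj hz)
    rw [tendsto_map'_iff]
    refine Tendsto.congr' ?_ tendsto_id
    filter_upwards [hD.mem_nhds hz] with x hx
    exact (hinv x hx).symm
  rintro _ ⟨z, hz, rfl⟩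
  refine DifferentiableAt.differentiableWithinAt (AnalyticAt.differentiableAt ?_)
  -- The derivative of `F` at `z` itself need not be examined: its zeros are isolated, so `G` is
  -- differentiable on a punctured neighbourhood of `F z`, and continuity removes the singularity.
  refine Complex.analyticAt_of_differentiable_on_punctured_nhds_of_continuousAt ?_ (hcont z hz)
  have hFa := hF.analyticAt (hD.mem_nhds hz)
  have hne : ∀ᶠ x in 𝓝[≠] z, deriv F x ≠ 0 := by
    refine hFa.deriv.eventually_eq_zero_or_eventually_ne_zero.resolve_left fun h => ?_
    refine hinj.not_eventually_const hD hz ?_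
    obtain ⟨r, hr, hball⟩ := Metric.eventually_nhds_iff_ball.1 (h.and (hD.mem_nhds hz))
    filter_upwards [Metric.ball_mem_nhds z hr] with x hx
    refine Metric.isOpen_ball.is_const_of_deriv_eq_zero (convex_ball z r).isPreconnected
      (hF.mono fun y hy => (hball y hy).2) (fun y hy => (hball y hy).1) hx
      (Metric.mem_ball_self hr)
  have htend : Tendsto G (𝓝[≠] (F z)) (𝓝[≠] z) := by
    refine tendsto_nhdsWithin_iff.2 ⟨?_, ?_⟩
    · have := (hcont z hz).tendsto
      rw [hinv z hz] at this
      exact this.mono_left nhdsWithin_le_nhds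
    · filter_upwards [self_mem_nhdsWithin,
        nhdsWithin_le_nhds (hopen.mem_nhds (mem_image_of_mem F hz))] with w hw hw'
      obtain ⟨y, hy, rfl⟩ := hw'
      rw [hinv y hy]
      rintro rfl
      exact hw rfl
  filter_upwards [htend.eventually hne,
    nhdsWithin_le_nhds (hopen.mem_nhds (mem_image_of_mem F hz))] with w hw hw'
  obtain ⟨y, hy, rfl⟩ := hw'
  rw [hinv y hy] at hw
  have hd : HasDerivAt F (deriv F y) (G (F y)) := by
    rw [hinv y hy]
    exact (hF.differentiableAt (hD.mem_nhds hy)).hasDerivAt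
  refine (HasDerivAt.of_local_left_inverse (hcont y hy) hd hw ?_).differentiableAt
  filter_upwards [hopen.mem_nhds (mem_image_of_mem F hy)] with v hv
  obtain ⟨x, hx, rfl⟩ := hv
  rw [hinv x hx]

/-! ### Uniqueness: Cayley transforms and the Schwarz lemma -/

lemma norm_sub_lt_norm_sub_conj {z p : ℂ} (hz : 0 < z.im) (hp : 0 < p.im) :
    ‖z - p‖ < ‖z - (starRingEnd ℂ) p‖ := by
  rw [← sq_lt_sq₀ (norm_nonneg _) (norm_nonneg _), ← Complex.normSq_eq_norm_sq,
    ← Complex.normSq_eq_norm_sq]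
  simp only [Complex.normSq_apply, Complex.sub_re, Complex.sub_im, Complex.conj_re,
    Complex.conj_im]
  nlinarith [mul_pos hz hp]

/-- The Cayley transform centred at a point of the upper half-plane. -/
noncomputable def cayley (p z : ℂ) : ℂ := (z - p) / (z - (starRingEnd ℂ) p)

/-- The inverse of the Cayley transform centred at a point of the upper half-plane. -/
noncomputable def cayleyInv (p w : ℂ) : ℂ := (p - w * (starRingEnd ℂ) p) / (1 - w)

lemma sub_conj_ne_zero {z p : ℂ} (hz : 0 < z.im) (hp : 0 < p.im) : z - (starRingEnd ℂ) p ≠ 0 := by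
  intro h
  have := congrArg Complex.im h
  simp at this
  linarith

lemma norm_cayley_lt_one {z p : ℂ} (hz : 0 < z.im) (hp : 0 < p.im) : ‖cayley p z‖ < 1 := by
  rw [cayley, norm_div, div_lt_one (norm_pos_iff.2 (sub_conj_ne_zero hz hp))]
  exact norm_sub_lt_norm_sub_conj hz hp

lemma one_sub_ne_zero_of_norm_lt {w : ℂ} (hw : ‖w‖ < 1) : 1 - w ≠ 0 := by
  intro h
  rw [← sub_eq_zero.1 h] at hw
  simp at hw

lemma cayleyInv_cayley {z p : ℂ} (hz : 0 < z.im) (hp : 0 < p.im) :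
    cayleyInv p (cayley p z) = z := by
  have h1 := sub_conj_ne_zero hz hp
  have h2 := sub_conj_ne_zero hp hp
  have h3 := one_sub_ne_zero_of_norm_lt (norm_cayley_lt_one hz hp)
  rw [cayleyInv, div_eq_iff h3]
  rw [cayley] at *
  field_simp
  ring

lemma cayleyInv_im_pos {w p : ℂ} (hw : ‖w‖ < 1) (hp : 0 < p.im) : 0 < (cayleyInv p w).im := by
  have h1 := one_sub_ne_zero_of_norm_lt hw
  have h2 := Complex.normSq_pos.2 h1
  have h3 : Complex.normSq w < 1 := by
    rw [Complex.normSq_eq_norm_sq]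
    exact pow_lt_one₀ (norm_nonneg _) hw two_ne_zero
  rw [cayleyInv, Complex.div_im, ← sub_div]
  refine div_pos ?_ h2
  simp only [Complex.normSq_apply] at h3
  simp
  nlinarith [mul_pos hp (sub_pos.2 h3)]

lemma cayley_cayleyInv {w p : ℂ} (hw : ‖w‖ < 1) (hp : 0 < p.im) :
    cayley p (cayleyInv p w) = w := by
  have h1 := one_sub_ne_zero_of_norm_lt hw
  have h2 := sub_conj_ne_zero (cayleyInv_im_pos hw hp) hp
  rw [cayley, div_eq_iff h2, cayleyInv]
  field_simp
  ring

/-- Transport of a map between domains conformally equivalent to the upper half-plane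
to a self-map of the unit disc, to which the Schwarz lemma applies. -/
lemma exists_disc_selfMap_of_isConformalOnto {D : Set ℂ} (hD : IsOpen D) {F F' : ℂ → ℂ}
    (hF : IsConformalOnto F D UpperHalfPlane.upperHalfPlaneSet)
    (hF' : IsConformalOnto F' D UpperHalfPlane.upperHalfPlaneSet) {z₀ : ℂ} (h₀ : z₀ ∈ D) :
    ∃ h : ℂ → ℂ, DifferentiableOn ℂ h (Metric.ball 0 1) ∧
      MapsTo h (Metric.ball 0 1) (Metric.ball 0 1) ∧ h 0 = 0 ∧
      ∀ z ∈ D, h (cayley (F z₀) (F z)) = cayley (F' z₀) (F' z) := by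
  have him : ∀ x ∈ D, 0 < (F x).im := fun x hx => hF.2.mapsTo hx
  have him' : ∀ x ∈ D, 0 < (F' x).im := fun x hx => hF'.2.mapsTo hx
  set G := Function.invFunOn F D with hG
  have hGl : ∀ x ∈ D, G (F x) = x := fun x hx => hF.2.injOn.leftInvOn_invFunOn hx
  have hGd := differentiableOn_leftInverse hD hF.1 hGl
  rw [hF.2.image_eq] at hGd
  have hGm : ∀ w : ℂ, 0 < w.im → G w ∈ D := fun w hw =>
    Function.invFunOn_mem (hF.2.surjOn (show w ∈ UpperHalfPlane.upperHalfPlaneSet from hw))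
  set h : ℂ → ℂ := fun w => cayley (F' z₀) (F' (G (cayleyInv (F z₀) w))) with hh
  have hmem : ∀ w ∈ Metric.ball (0 : ℂ) 1, 0 < (cayleyInv (F z₀) w).im := fun w hw =>
    cayleyInv_im_pos (by simpa using hw) (him _ h₀)
  have hd : DifferentiableOn ℂ h (Metric.ball 0 1) := by
    have h1 : DifferentiableOn ℂ (cayleyInv (F z₀)) (Metric.ball 0 1) := by
      unfold cayleyInv
      refine DifferentiableOn.div (by fun_prop) (by fun_prop) fun w hw => ?_
      exact one_sub_ne_zero_of_norm_lt (by simpa using hw)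
    have h2 := hF'.1.comp (hGd.comp h1 hmem) (fun w hw => hGm _ (hmem w hw))
    refine DifferentiableOn.div (h2.sub_const _) (h2.sub_const _) fun w hw => ?_
    exact sub_conj_ne_zero (him' _ (hGm _ (hmem w hw))) (him' _ h₀)
  have hmaps : MapsTo h (Metric.ball 0 1) (Metric.ball 0 1) := by
    intro w hw
    simpa using norm_cayley_lt_one (him' _ (hGm _ (hmem w hw))) (him' _ h₀)
  have h0 : h 0 = 0 := by
    have : cayleyInv (F z₀) 0 = F z₀ := by simp [cayleyInv]
    simp [hh, this, hGl _ h₀, cayley]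
  refine ⟨h, hd, hmaps, h0, fun z hz => ?_⟩
  simp only [hh, cayleyInv_cayley (him _ hz) (him _ h₀), hGl _ hz]

/-- The transported map and the one transported in the opposite direction both satisfy the Schwarz
inequality, so equality holds and the disc map is linear. -/
lemma exists_cayley_eq_mul_of_isConformalOnto {D : Set ℂ} (hD : IsOpen D) {F F' : ℂ → ℂ}
    (hF : IsConformalOnto F D UpperHalfPlane.upperHalfPlaneSet)
    (hF' : IsConformalOnto F' D UpperHalfPlane.upperHalfPlaneSet) {z₀ : ℂ} (h₀ : z₀ ∈ D) :
    ∃ c : ℂ, ∀ z ∈ D, cayley (F' z₀) (F' z) = c * cayley (F z₀) (F z) := by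
  have him : ∀ x ∈ D, 0 < (F x).im := fun x hx => hF.2.mapsTo hx
  have him' : ∀ x ∈ D, 0 < (F' x).im := fun x hx => hF'.2.mapsTo hx
  obtain ⟨h, hd, hm, h0, heq⟩ := exists_disc_selfMap_of_isConformalOnto hD hF hF' h₀
  obtain ⟨k, kd, km, k0, keq⟩ := exists_disc_selfMap_of_isConformalOnto hD hF' hF h₀
  -- Any nonzero point of the disc would serve to test the equality case.
  have hhalf : ‖(1 / 2 : ℂ)‖ < 1 := by norm_num
  obtain ⟨z, hz, hzw⟩ : ∃ z ∈ D, cayley (F z₀) (F z) = 1 / 2 := by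
    obtain ⟨z, hz, h⟩ := hF.2.surjOn
      (show cayleyInv (F z₀) (1 / 2) ∈ UpperHalfPlane.upperHalfPlaneSet from
        cayleyInv_im_pos hhalf (him _ h₀))
    exact ⟨z, hz, by rw [h, cayley_cayleyInv hhalf (him _ h₀)]⟩
  have hnorm : ‖h (1 / 2)‖ = ‖(1 / 2 : ℂ)‖ := by
    have h1 := Complex.norm_le_norm_of_mapsTo_ball hd
      (hm.mono_right Metric.ball_subset_closedBall) h0 (norm_cayley_lt_one (him _ hz) (him _ h₀))
    have h2 := Complex.norm_le_norm_of_mapsTo_ball kd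
      (km.mono_right Metric.ball_subset_closedBall) k0
      (norm_cayley_lt_one (him' _ hz) (him' _ h₀))
    rw [keq z hz, ← heq z hz] at h2
    rw [hzw] at h1 h2
    exact le_antisymm h1 h2
  obtain ⟨c, -, hc⟩ := Complex.affine_of_mapsTo_ball_of_exists_norm_dslope_eq_div' hd
    (R₂ := 1) (by rw [h0]; exact hm.mono_right Metric.ball_subset_closedBall)
    ⟨1 / 2, by simpa using hhalf, by
      rw [dslope_of_ne _ (by norm_num), slope_def_field, h0, sub_zero, sub_zero, norm_div, hnorm]
      norm_num⟩
  refine ⟨c, fun z hz => ?_⟩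
  rw [← heq z hz, hc (by simpa using norm_cayley_lt_one (him _ hz) (him _ h₀)), h0]
  simp [mul_comm]

/-- A conformal map onto the upper half-plane is determined by where it takes the limits
`0`, `1` and `∞`. -/
lemma eqOn_of_isConformalOnto {D : Set ℂ} (hD : IsOpen D) {F F' : ℂ → ℂ}
    (hF : IsConformalOnto F D UpperHalfPlane.upperHalfPlaneSet)
    (hF' : IsConformalOnto F' D UpperHalfPlane.upperHalfPlaneSet)
    {a b c : ℂ} (ha : a ∈ closure D) (hb : b ∈ closure D) (hc : c ∈ closure D)
    (hFa : SendsTo F D a 0) (hFb : SendsTo F D b 1) (hFc : SendsToInfty F D c)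
    (hFa' : SendsTo F' D a 0) (hFb' : SendsTo F' D b 1) (hFc' : SendsToInfty F' D c) :
    EqOn F' F D := by
  rcases D.eq_empty_or_nonempty with rfl | ⟨z₀, h₀⟩
  · exact fun x hx => hx.elim
  have := mem_closure_iff_nhdsWithin_neBot.1 ha
  have := mem_closure_iff_nhdsWithin_neBot.1 hb
  have := mem_closure_iff_nhdsWithin_neBot.1 hc
  have him : ∀ x ∈ D, 0 < (F x).im := fun x hx => hF.2.mapsTo hx
  have him' : ∀ x ∈ D, 0 < (F' x).im := fun x hx => hF'.2.mapsTo hx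
  obtain ⟨k, hk⟩ := exists_cayley_eq_mul_of_isConformalOnto hD hF hF' h₀
  set p := F z₀
  set p' := F' z₀
  set cp := (starRingEnd ℂ) p with hcp
  set cp' := (starRingEnd ℂ) p' with hcp'
  -- With denominators cleared, the relation is polynomial in the two maps and passes to limits at
  -- boundary points.
  have hbil : ∀ z ∈ D, (F' z - p') * (F z - cp) - k * ((F z - p) * (F' z - cp')) = 0 := by
    intro z hz
    have h1 : F z - cp ≠ 0 := sub_conj_ne_zero (him z hz) (him _ h₀)
    have h2 : F' z - cp' ≠ 0 := sub_conj_ne_zero (him' z hz) (him' _ h₀)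
    have h3 : (F' z - p') / (F' z - cp') = k * ((F z - p) / (F z - cp)) := hk z hz
    rw [← mul_div_assoc, div_eq_div_iff h2 h1] at h3
    linear_combination h3
  have hlim : ∀ {x : ℂ} {v : ℂ}, (𝓝[D] x).NeBot → SendsTo F D x v → SendsTo F' D x v →
      (v - p') * (v - cp) - k * ((v - p) * (v - cp')) = 0 := by
    intro x v hne h h'
    have ht : Tendsto (fun z => (F' z - p') * (F z - cp) - k * ((F z - p) * (F' z - cp')))
        (𝓝[D] x) (𝓝 ((v - p') * (v - cp) - k * ((v - p) * (v - cp')))) :=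
      ((h'.sub_const _).mul (h.sub_const _)).sub
        (((h.sub_const _).mul (h'.sub_const _)).const_mul k)
    refine tendsto_nhds_unique ht (tendsto_const_nhds.congr' ?_)
    filter_upwards [self_mem_nhdsWithin] with z hz
    exact (hbil z hz).symm
  have e0 := hlim ‹_› hFa hFa'
  have e1 := hlim ‹_› hFb hFb'
  -- Dividing the relation by `F z * F' z` and letting both values tend to infinity leaves 1 - k =
  -- 0.
  have hk1 : k = 1 := by
    have i1 := tendsto_inv₀_cobounded.comp hFc
    have i2 := tendsto_inv₀_cobounded.comp hFc'
    have ht : Tendsto (fun z => (1 - p' * (F' z)⁻¹) * (1 - cp * (F z)⁻¹)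
        - k * ((1 - p * (F z)⁻¹) * (1 - cp' * (F' z)⁻¹)))
        (𝓝[D] c) (𝓝 ((1 - p' * 0) * (1 - cp * 0) - k * ((1 - p * 0) * (1 - cp' * 0)))) :=
      (((i2.const_mul _).const_sub _).mul ((i1.const_mul _).const_sub _)).sub
        ((((i1.const_mul _).const_sub _).mul ((i2.const_mul _).const_sub _)).const_mul k)
    have h0 := tendsto_nhds_unique ht (tendsto_const_nhds (x := (0 : ℂ)) |>.congr' ?_)
    · linear_combination -h0
    · filter_upwards [self_mem_nhdsWithin] with z hz
      have n1 : F z ≠ 0 := fun h => by simpa [h] using him z hz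
      have n2 : F' z ≠ 0 := fun h => by simpa [h] using him' z hz
      field_simp
      linear_combination -hbil z hz
  subst hk1
  intro z hz
  have hz' := hbil z hz
  have hpc := sub_conj_ne_zero (him _ h₀) (him _ h₀)
  -- For k = 1 the quadratic terms cancel. The limit 0 kills the constant term, and the limit 1 then
  -- equates the coefficients p - p̄ and p' - p̄'.
  refine sub_eq_zero.1 ((mul_eq_zero.1 (?_ : (p - cp) * (F' z - F z) = 0)).resolve_left hpc)
  linear_combination hz' - e0 + F z * (e0 - e1)

/-! ### Surjectivity from boundary behaviour -/

/-- A criterion for a map to be conformal onto the upper half-plane: injectivity, real boundary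
values, and a single boundary point sent to infinity. -/
lemma isConformalOnto_upperHalfPlane {D : Set ℂ} (hD : IsOpen D) (hconn : IsPreconnected D)
    (hbd : Bornology.IsBounded D) {F : ℂ → ℂ} {c : ℂ}
    (hF : DifferentiableOn ℂ F D) (hinj : InjOn F D)
    (hcont : ∀ z ∈ closure D, z ≠ c → ContinuousAt F z)
    (hc : SendsToInfty F D c)
    (hreal : ∀ z ∈ closure D, z ∉ D → z ≠ c → (F z).im = 0)
    (him : ∀ z ∈ D, (F z).im ≠ 0) (hpos : ∃ z ∈ D, 0 < (F z).im) :
    IsConformalOnto F D UpperHalfPlane.upperHalfPlaneSet := by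
  obtain ⟨z₀, hz₀, hz₀pos⟩ := hpos
  have hmaps : ∀ z ∈ D, 0 < (F z).im := by
    intro z hz
    by_contra hneg
    obtain ⟨x, hx, hx0⟩ := hconn.intermediate_value₂ hz hz₀
      (Complex.continuous_im.comp_continuousOn hF.continuousOn) continuousOn_const
      (not_lt.1 hneg) hz₀pos.le
    exact him x hx hx0
  refine ⟨hF, hmaps, hinj, ?_⟩
  have hUc : IsPreconnected UpperHalfPlane.upperHalfPlaneSet :=
    (convex_halfSpace_im_gt 0).isPreconnected
  -- The image is open; it remains to show that it is relatively closed in the connected half-plane.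
  -- A limit of values comes from a limit of preimages in the closure, which cannot lie on the
  -- boundary: values there are real or infinite.
  refine hUc.subset_of_closure_inter_subset (isOpen_image_of_injOn hD hF hinj)
    ⟨F z₀, hz₀pos, mem_image_of_mem F hz₀⟩ ?_
  rintro w ⟨hw, hwpos⟩
  obtain ⟨u, hu, hulim⟩ := mem_closure_iff_seq_limit.1 hw
  choose x hx hxu using hu
  obtain ⟨z, hz, φ, hφ, hlim⟩ := hbd.isCompact_closure.tendsto_subseq
    (fun n => subset_closure (hx n))
  have hul : Tendsto (fun n => F (x (φ n))) atTop (𝓝 w) := by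
    simpa only [hxu, Function.comp_def] using hulim.comp hφ.tendsto_atTop
  by_cases hzc : z = c
  · subst hzc
    have h1 : Tendsto (fun n => F (x (φ n))) atTop (Bornology.cobounded ℂ) :=
      Tendsto.comp hc (tendsto_nhdsWithin_iff.2 ⟨hlim, .of_forall fun n => hx _⟩)
    exact absurd h1 (hul.not_tendsto (Metric.disjoint_nhds_cobounded w))
  · have h1 : Tendsto (fun n => F (x (φ n))) atTop (𝓝 (F z)) :=
      (hcont z hz hzc).tendsto.comp hlim
    have h2 := tendsto_nhds_unique hul h1
    by_cases hzD : z ∈ D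
    · exact ⟨z, hzD, h2.symm⟩
    · have h3 := hreal z hz hzD hzc
      rw [← h2] at h3
      exact absurd h3 (ne_of_gt hwpos)

/-! ### Quotients and Liouville's theorem on the punctured plane -/

/-- Division of holomorphic functions when the zeros of the divisor are simple and shared. -/
lemma exists_differentiableOn_eq_mul {U : Set ℂ} (hU : IsOpen U) {E D : ℂ → ℂ}
    (hE : DifferentiableOn ℂ E U) (hD : DifferentiableOn ℂ D U)
    (hzero : ∀ w ∈ U, D w = 0 → E w = 0 ∧ deriv D w ≠ 0) :
    ∃ G : ℂ → ℂ, DifferentiableOn ℂ G U ∧ ∀ w ∈ U, E w = G w * D w := by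
  classical
  refine ⟨fun w => if D w = 0 then deriv E w / deriv D w else E w / D w, fun w hw => ?_,
    fun w hw => ?_⟩
  · refine DifferentiableAt.differentiableWithinAt ?_
    have hEw := hE.differentiableAt (hU.mem_nhds hw)
    have hDw := hD.differentiableAt (hU.mem_nhds hw)
    by_cases h0 : D w = 0
    · obtain ⟨hE0, hD1⟩ := hzero w hw h0
      have hdE : DifferentiableAt ℂ (dslope E w) w :=
        ((Complex.differentiableOn_dslope (hU.mem_nhds hw)).2 hE).differentiableAt
          (hU.mem_nhds hw)
      have hdD : DifferentiableAt ℂ (dslope D w) w :=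
        ((Complex.differentiableOn_dslope (hU.mem_nhds hw)).2 hD).differentiableAt
          (hU.mem_nhds hw)
      -- Near a common zero the quotient is the ratio of the two difference quotients `dslope`,
      -- whose denominator is nonzero at `w`.
      refine (hdE.div hdD (by rwa [dslope_same])).congr_of_eventuallyEq ?_
      have hne : ∀ᶠ x in 𝓝[≠] w, D x ≠ 0 :=
        hDw.hasDerivAt.eventually_ne hD1
      rw [eventually_nhdsWithin_iff] at hne
      filter_upwards [hne] with x hx
      by_cases hxw : x = w
      · subst hxw
        simp [h0]
      · have hx0 := hx hxw
        have hsub : x - w ≠ 0 := sub_ne_zero.2 hxw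
        simp only [hx0, if_false, Pi.div_apply, dslope_of_ne _ hxw, slope_def_field, h0, hE0,
          sub_zero]
        field_simp
    · refine (hEw.div hDw h0).congr_of_eventuallyEq ?_
      filter_upwards [hDw.continuousAt.eventually_ne h0] with x hx
      simp [hx]
  · by_cases h0 : D w = 0
    · simp [h0, (hzero w hw h0).1]
    · simp [h0]

/-- A holomorphic function on `ℂ \ {0}` invariant under `w ↦ p w`, `0 < |p| < 1`, is constant. -/
lemma eq_const_of_mul_invariant {p : ℂ} (hp0 : p ≠ 0) (hp : ‖p‖ < 1) {G : ℂ → ℂ}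
    (hG : DifferentiableOn ℂ G {0}ᶜ) (hinv : ∀ w, w ≠ 0 → G (p * w) = G w)
    {a b : ℂ} (ha : a ≠ 0) (hb : b ≠ 0) : G a = G b := by
  have hpos : 0 < ‖p‖ := norm_pos_iff.2 hp0
  have hpz : ∀ (m : ℤ) w, w ≠ 0 → G (p ^ m * w) = G w := by
    intro m w hw
    induction m using Int.induction_on with
    | zero => simp
    | succ n ih =>
      rw [zpow_add_one₀ hp0, mul_comm _ p, mul_assoc,
        hinv _ (mul_ne_zero (zpow_ne_zero _ hp0) hw), ih]
    | pred n ih =>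
      rw [← ih, ← hinv (p ^ (-(n : ℤ) - 1) * w) (mul_ne_zero (zpow_ne_zero _ hp0) hw),
        ← mul_assoc, zpow_sub_one₀ hp0]
      congr 2
      field_simp
  have hcomp : IsCompact (Metric.closedBall (0 : ℂ) 1 \ Metric.ball 0 ‖p‖) :=
    (isCompact_closedBall 0 1).diff Metric.isOpen_ball
  have hsub : Metric.closedBall (0 : ℂ) 1 \ Metric.ball 0 ‖p‖ ⊆ {0}ᶜ := by
    rintro w ⟨-, hw⟩ rfl
    exact hw (Metric.mem_ball_self hpos)
  have hbdd : Bornology.IsBounded (range (G ∘ Complex.exp)) := by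
    refine (hcomp.image_of_continuousOn (hG.continuousOn.mono hsub)).isBounded.subset ?_
    rintro _ ⟨z, rfl⟩
    have hw := Complex.exp_ne_zero z
    set w := Complex.exp z
    -- The exponent n + 1 brings `w` into the compact fundamental annulus between the radii |p| and
    -- 1, which bounds `G ∘ exp`.
    obtain ⟨n, hn1, hn2⟩ := exists_mem_Ioc_zpow (norm_pos_iff.2 hw) ((one_lt_inv₀ hpos).2 hp)
    refine ⟨p ^ (n + 1) * w, ⟨?_, ?_⟩, hpz _ _ hw⟩
    · simp only [mem_closedBall_zero_iff, norm_mul, norm_zpow]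
      rw [inv_zpow] at hn2
      rwa [← le_inv_mul_iff₀ (zpow_pos hpos _), mul_one]
    · simp only [mem_ball_zero_iff, norm_mul, norm_zpow, not_lt]
      rw [inv_zpow, inv_lt_iff_one_lt_mul₀ (zpow_pos hpos _)] at hn1
      rw [zpow_add_one₀ hpos.ne']
      nlinarith
  have hdiff : Differentiable ℂ (G ∘ Complex.exp) := fun z =>
    (hG.differentiableAt (isOpen_compl_singleton.mem_nhds (Complex.exp_ne_zero z))).comp z
      Complex.differentiable_exp.differentiableAt
  have := hdiff.apply_eq_apply_of_bounded hbdd (Complex.log a) (Complex.log b)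
  simpa [Complex.exp_log, ha, hb] using this

/-! ### The q-product and the theta product -/

/-- The infinite product `∏ (1 - pⁿ w)` over `n ≥ 0`. -/
noncomputable def qProd (p w : ℂ) : ℂ := ∏' n : ℕ, (1 - p ^ n * w)

lemma summable_norm_pow_mul {p : ℂ} (hp : ‖p‖ < 1) (w : ℂ) :
    Summable fun n : ℕ => ‖-(p ^ n * w)‖ := by
  simpa using (summable_geometric_of_lt_one (norm_nonneg _) hp).mul_right ‖w‖

lemma multipliable_one_sub_pow_mul {p : ℂ} (hp : ‖p‖ < 1) (w : ℂ) :
    Multipliable fun n : ℕ => 1 - p ^ n * w := by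
  simpa only [sub_eq_add_neg] using multipliable_one_add_of_summable (summable_norm_pow_mul hp w)

lemma qProd_eq_mul {p : ℂ} (hp : ‖p‖ < 1) (w : ℂ) : qProd p w = (1 - w) * qProd p (p * w) := by
  have h : (fun n : ℕ => 1 - p ^ (n + 1) * w) = fun n => 1 - p ^ n * (p * w) := by
    ext n
    ring
  have h2 := tprod_eq_zero_mul' (f := fun n : ℕ => 1 - p ^ n * w)
    (by rw [h]; exact multipliable_one_sub_pow_mul hp _)
  rw [qProd, h2, h]
  simp [qProd]

lemma differentiable_qProd {p : ℂ} (hp : ‖p‖ < 1) : Differentiable ℂ (qProd p) := by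
  intro w₀
  have h := Summable.hasProdLocallyUniformlyOn_nat_one_add (R := ℂ)
    (f := fun (n : ℕ) (w : ℂ) => -(p ^ n * w)) (Metric.isOpen_ball (x := (0 : ℂ)) (ε := ‖w₀‖ + 1))
    ((summable_geometric_of_lt_one (norm_nonneg _) hp).mul_right (‖w₀‖ + 1))
    (.of_forall fun n w hw => by
      rw [norm_neg, norm_mul, norm_pow]
      gcongr
      exact (mem_ball_zero_iff.1 hw).le) (fun n => by fun_prop)
  have hd := h.differentiableOn (.of_forall fun s => by
    simpa [Finset.prod_fn] using DifferentiableOn.finsetProd (fun _ _ => by fun_prop))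
    Metric.isOpen_ball
  simp only [← sub_eq_add_neg] at hd
  exact hd.differentiableAt (Metric.isOpen_ball.mem_nhds (by simp))

/-- Dominated convergence with a geometric majorant. Both arguments vary, since the base and the
point move together with the nome. -/
lemma tendsto_qProd {α : Type*} {l : Filter α} {p w : α → ℂ} {p₀ w₀ : ℂ} (hp₀ : ‖p₀‖ < 1)
    (hp : Tendsto p l (𝓝 p₀)) (hw : Tendsto w l (𝓝 w₀)) :
    Tendsto (fun x => qProd (p x) (w x)) l (𝓝 (qProd p₀ w₀)) := by
  obtain ⟨r, hr1, hr2⟩ := exists_between hp₀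
  have hr0 : 0 ≤ r := (norm_nonneg _).trans hr1.le
  have h := tendsto_tprod_one_add_of_dominated_convergence (R := ℂ) (𝓕 := l)
    (f := fun x (n : ℕ) => -(p x ^ n * w x)) (g := fun n => -(p₀ ^ n * w₀))
    (bound := fun n => r ^ n * (‖w₀‖ + 1))
    ((summable_geometric_of_lt_one hr0 hr2).mul_right _)
    (fun n => ((hp.pow n).mul hw).neg) (by
      filter_upwards [hp.norm.eventually_lt_const hr1,
        hw.norm.eventually_lt_const (lt_add_one ‖w₀‖)] with x h1 h2 n
      rw [norm_neg, norm_mul, norm_pow]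
      gcongr)
  simpa only [qProd, ← sub_eq_add_neg] using h

lemma exists_of_qProd_eq_zero {p : ℂ} (hp : ‖p‖ < 1) {w : ℂ} (h : qProd p w = 0) :
    ∃ n : ℕ, p ^ n * w = 1 := by
  by_contra! hne
  refine tprod_one_add_ne_zero_of_summable (f := fun n : ℕ => -(p ^ n * w)) (fun n => ?_)
    (summable_norm_pow_mul hp w) (by simpa only [qProd, ← sub_eq_add_neg] using h)
  rw [← sub_eq_add_neg, sub_ne_zero]
  exact (hne n).symm

lemma qProd_conj {p : ℝ} (hp : ‖(p : ℂ)‖ < 1) (w : ℂ) :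
    qProd p ((starRingEnd ℂ) w) = (starRingEnd ℂ) (qProd p w) := by
  rw [qProd, qProd, (multipliable_one_sub_pow_mul hp w).map_tprod (starRingEnd ℂ)
    Complex.continuous_conj]
  simp

/-- Factorwise comparison; the monotonicity of the corner position in the nome rests on it. -/
lemma norm_qProd_le {p w p' w' : ℂ} (hp : ‖p‖ < 1) (hp' : ‖p'‖ < 1)
    (h : ∀ n : ℕ, ‖1 - p ^ n * w‖ ≤ ‖1 - p' ^ n * w'‖) : ‖qProd p w‖ ≤ ‖qProd p' w'‖ := by
  have h1 := (multipliable_one_sub_pow_mul hp w).hasProd.tendsto_prod_nat.norm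
  have h2 := (multipliable_one_sub_pow_mul hp' w').hasProd.tendsto_prod_nat.norm
  refine le_of_tendsto_of_tendsto' h1 h2 fun n => ?_
  rw [norm_prod, norm_prod]
  exact Finset.prod_le_prod (fun _ _ => norm_nonneg _) fun i _ => h i

lemma qProd_zero_right (p : ℂ) : qProd p 0 = 1 := by simp [qProd]

/-- The theta product `∏ (1 - pⁿ w) (1 - pⁿ⁺¹ / w)`, with simple zeros at the powers of `p`. -/
noncomputable def thetaProd (p w : ℂ) : ℂ := qProd p w * qProd p (p / w)

section

variable {p : ℂ}

/-- The shift removes the factor 1 - w from the first product and adds 1 - 1/w to the second; their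
ratio is -1/w. -/
lemma thetaProd_mul (hp0 : p ≠ 0) (hp : ‖p‖ < 1) {w : ℂ} (hw : w ≠ 0) :
    thetaProd p (p * w) * w = -thetaProd p w := by
  have h1 : p / (p * w) = 1 / w := by field_simp
  have h2 := qProd_eq_mul hp w
  have h3 := qProd_eq_mul hp (1 / w)
  rw [mul_one_div] at h3
  rw [thetaProd, thetaProd, h1, h2, h3]
  field_simp
  ring

lemma thetaProd_inv (hp0 : p ≠ 0) (hp : ‖p‖ < 1) {w : ℂ} (hw : w ≠ 0) :
    thetaProd p (1 / w) * w = -thetaProd p w := by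
  rw [← thetaProd_mul hp0 hp hw, thetaProd, thetaProd, div_div_eq_mul_div, div_one,
    div_mul_cancel_left₀ hp0, one_div]
  ring

lemma differentiableAt_thetaProd (hp : ‖p‖ < 1) {w : ℂ} (hw : w ≠ 0) :
    DifferentiableAt ℂ (thetaProd p) w := by
  have h1 := differentiable_qProd hp
  have h2 : DifferentiableAt ℂ (fun w => p / w) w := by fun_prop (disch := assumption)
  exact h1.differentiableAt.mul (h1.differentiableAt.comp w h2)

lemma thetaProd_one (p : ℂ) (hp : ‖p‖ < 1) : thetaProd p 1 = 0 := by
  rw [thetaProd, qProd_eq_mul hp]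
  simp

lemma exists_of_thetaProd_eq_zero (hp0 : p ≠ 0) (hp : ‖p‖ < 1) {w : ℂ} (hw : w ≠ 0)
    (h : thetaProd p w = 0) : ∃ m : ℤ, w = p ^ m := by
  rcases mul_eq_zero.1 h with h | h
  · obtain ⟨n, hn⟩ := exists_of_qProd_eq_zero hp h
    refine ⟨-n, ?_⟩
    rw [zpow_neg, zpow_natCast]
    exact eq_inv_of_mul_eq_one_right hn
  · obtain ⟨n, hn⟩ := exists_of_qProd_eq_zero hp h
    refine ⟨n + 1, ?_⟩
    field_simp at hn
    rw [zpow_add_one₀ hp0, zpow_natCast, ← hn]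

lemma iterate_zpow_mul (hp0 : p ≠ 0) {S : ℂ → Prop} (hS : ∀ w, w ≠ 0 → (S (p * w) ↔ S w))
    (m : ℤ) {w : ℂ} (hw : w ≠ 0) : S (p ^ m * w) ↔ S w := by
  induction m using Int.induction_on with
  | zero => simp
  | succ n ih =>
    rw [zpow_add_one₀ hp0, mul_comm _ p, mul_assoc]
    exact (hS _ (mul_ne_zero (zpow_ne_zero _ hp0) hw)).trans ih
  | pred n ih =>
    have h := hS (p ^ (-(n : ℤ) - 1) * w) (mul_ne_zero (zpow_ne_zero _ hp0) hw)
    rw [← mul_assoc, ← zpow_one_add₀ hp0, add_sub_cancel] at h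
    exact h.symm.trans ih

/-- Every zero is a power of `p`, and differentiating the functional equation shows that simplicity
of a zero is invariant under w ↦ pw. Hence only the zero at 1 has to be examined. -/
lemma deriv_thetaProd_ne_zero (hp0 : p ≠ 0) (hp : ‖p‖ < 1) {w : ℂ} (hw : w ≠ 0)
    (h : thetaProd p w = 0) : deriv (thetaProd p) w ≠ 0 := by
  have hz : ∀ w, w ≠ 0 → (thetaProd p (p * w) = 0 ↔ thetaProd p w = 0) := fun w hw => by
    rw [← neg_eq_zero (a := thetaProd p w), ← thetaProd_mul hp0 hp hw]
    simp [hw]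
  have hS : ∀ w, w ≠ 0 → ((thetaProd p (p * w) = 0 ∧ deriv (thetaProd p) (p * w) ≠ 0) ↔
      (thetaProd p w = 0 ∧ deriv (thetaProd p) w ≠ 0)) := by
    intro w hw
    rw [hz w hw]
    refine and_congr_right fun h0 => not_congr ?_
    have hpw := mul_ne_zero hp0 hw
    have h1 : HasDerivAt (fun x => thetaProd p (p * x) * x)
        (deriv (thetaProd p) (p * w) * p * w + thetaProd p (p * w) * 1) w :=
      HasDerivAt.mul (((differentiableAt_thetaProd hp hpw).hasDerivAt).comp w
        (by simpa using (hasDerivAt_id w).const_mul p)) (hasDerivAt_id w)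
    have h2 : HasDerivAt (fun x => thetaProd p (p * x) * x) (-deriv (thetaProd p) w) w := by
      refine (differentiableAt_thetaProd hp hw).hasDerivAt.neg.congr_of_eventuallyEq ?_
      filter_upwards [isOpen_compl_singleton.mem_nhds hw] with x hx
      exact thetaProd_mul hp0 hp hx
    have h3 := h1.unique h2
    rw [(hz w hw).2 h0, zero_mul, add_zero] at h3
    rw [← neg_eq_zero (a := deriv (thetaProd p) w), ← h3]
    simp [hp0, hw]
  obtain ⟨m, rfl⟩ := exists_of_thetaProd_eq_zero hp0 hp hw h
  have := (iterate_zpow_mul hp0 (S := fun w => thetaProd p w = 0 ∧ deriv (thetaProd p) w ≠ 0) hS m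
    one_ne_zero).2
  rw [mul_one] at this
  refine (this ⟨thetaProd_one p hp, ?_⟩).2
  -- Once 1 - w is split off, the cofactor at 1 is the square of `qProd p p`, which is nonzero
  -- because no p^(n+1) equals 1.
  have heq : thetaProd p = fun w => (1 - w) * (qProd p (p * w) * qProd p (p / w)) := by
    ext w
    rw [thetaProd, qProd_eq_mul hp w, mul_assoc]
  have hq := differentiable_qProd hp
  have hd : DifferentiableAt ℂ (fun w => qProd p (p * w) * qProd p (p / w)) 1 :=
    (hq.differentiableAt.comp 1 (f := fun w => p * w) (by fun_prop)).mul
      (hq.differentiableAt.comp 1 (f := fun w => p / w) (by fun_prop (disch := norm_num)))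
  rw [heq, (((hasDerivAt_id' (1 : ℂ)).const_sub 1).fun_mul hd.hasDerivAt).deriv]
  have hne : qProd p p ≠ 0 := by
    intro h0
    obtain ⟨n, hn⟩ := exists_of_qProd_eq_zero hp h0
    have := congrArg norm hn
    rw [← pow_succ, norm_pow, norm_one] at this
    exact (pow_lt_one₀ (norm_nonneg _) hp n.succ_ne_zero).ne this
  simp [hne]

end

lemma thetaProd_conj {p : ℝ} (hp : ‖(p : ℂ)‖ < 1) (w : ℂ) :
    thetaProd p ((starRingEnd ℂ) w) = (starRingEnd ℂ) (thetaProd p w) := by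
  rw [thetaProd, thetaProd, map_mul, ← qProd_conj hp, ← qProd_conj hp]
  simp

/-! ### Weierstrass' three-term identity and Jacobi's quartic identity -/

/-- Weierstrass' three-term identity, for generic parameter `a`. -/
lemma thetaProd_three_term_of_generic {q : ℂ} (hq0 : q ≠ 0) (hq : ‖q‖ < 1) {a w : ℂ} (ha : a ≠ 0)
    (hw : w ≠ 0) (hgen : ∀ m : ℤ, a ^ 2 ≠ (q ^ 2) ^ m) :
    thetaProd (q ^ 2) (-w) ^ 2 * thetaProd (q ^ 2) (-(q * a)) ^ 2 * a
      - thetaProd (q ^ 2) (-a) ^ 2 * thetaProd (q ^ 2) (-(q * w)) ^ 2 * w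
      = a * thetaProd (q ^ 2) q ^ 2 * (thetaProd (q ^ 2) (w * a) * thetaProd (q ^ 2) (w / a)) := by
  have hp0 : q ^ 2 ≠ 0 := pow_ne_zero 2 hq0
  have hp : ‖q ^ 2‖ < 1 := by
    rw [norm_pow]
    exact pow_lt_one₀ (norm_nonneg _) hq two_ne_zero
  set P := thetaProd (q ^ 2) with hP
  have hmul : ∀ {x : ℂ}, x ≠ 0 → P (q ^ 2 * x) * x = -P x := fun hx => thetaProd_mul hp0 hp hx
  have hinv : ∀ {x : ℂ}, x ≠ 0 → P (1 / x) * x = -P x := fun hx => thetaProd_inv hp0 hp hx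
  have hdiff : ∀ {x : ℂ}, x ≠ 0 → DifferentiableAt ℂ P x :=
    fun hx => differentiableAt_thetaProd hp hx
  set E : ℂ → ℂ := fun w => P (-w) ^ 2 * P (-(q * a)) ^ 2 * a - P (-a) ^ 2 * P (-(q * w)) ^ 2 * w
    with hE
  set D : ℂ → ℂ := fun w => P (w * a) * P (w / a) with hD
  -- `E` and `D` have the same multiplier w⁻² under w ↦ q²w. As `E` vanishes at the zeros of `D`,
  -- the quotient `G` is holomorphic and invariant, hence constant.
  have hEmul : ∀ w, w ≠ 0 → E (q ^ 2 * w) * w ^ 2 = E w := by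
    intro w hw
    have h1 := hmul (neg_ne_zero.2 hw)
    have h2 := hmul (neg_ne_zero.2 (mul_ne_zero hq0 hw))
    have e1 : q ^ 2 * -w = -(q ^ 2 * w) := by ring
    have e2 : q ^ 2 * -(q * w) = -(q * (q ^ 2 * w)) := by ring
    rw [e1] at h1
    rw [e2] at h2
    have h3 : P (-(q ^ 2 * w)) ^ 2 * w ^ 2 = P (-w) ^ 2 := by
      linear_combination (P (-(q ^ 2 * w)) * -w - P (-w)) * h1
    have h4 : P (-(q * (q ^ 2 * w))) ^ 2 * (q ^ 2 * w ^ 2) = P (-(q * w)) ^ 2 := by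
      linear_combination (P (-(q * (q ^ 2 * w))) * -(q * w) - P (-(q * w))) * h2
    simp only [hE]
    linear_combination (P (-(q * a)) ^ 2 * a) * h3 - P (-a) ^ 2 * w * h4
  have hDmul : ∀ w, w ≠ 0 → D (q ^ 2 * w) * w ^ 2 = D w := by
    intro w hw
    have h1 := hmul (mul_ne_zero hw ha)
    have h2 := hmul (div_ne_zero hw ha)
    simp only [hD]
    rw [mul_assoc (q ^ 2) w a, mul_div_assoc]
    have : w ^ 2 = (w * a) * (w / a) := by field_simp
    rw [this]
    linear_combination (P (q ^ 2 * (w / a)) * (w / a)) * h1 - P (w * a) * h2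
  have hEiter : ∀ (m : ℤ) {w}, w ≠ 0 → (E ((q ^ 2) ^ m * w) = 0 ↔ E w = 0) := fun m w hw =>
    iterate_zpow_mul hp0 (S := fun w => E w = 0) (fun w hw => by
      rw [← hEmul w hw]
      simp [hw]) m hw
  have hEa : E a = 0 := by
    simp only [hE]
    ring
  have hEainv : E (1 / a) = 0 := by
    have h1 := hinv (neg_ne_zero.2 ha)
    have hqa := neg_ne_zero.2 (mul_ne_zero hq0 ha)
    have h2 := hinv hqa
    have h3 := hmul (one_div_ne_zero hqa)
    have e1 : 1 / -a = -(1 / a) := by rw [div_neg]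
    have e2 : q ^ 2 * (1 / -(q * a)) = -(q * (1 / a)) := by field_simp
    rw [e1] at h1
    rw [e2] at h3
    have h5 : P (-(q * (1 / a))) = P (-(q * a)) := by
      have h6 : P (-(q * (1 / a))) * (1 / -(q * a)) * -(q * a) = P (-(q * a)) := by
        rw [h3]
        linear_combination -h2
      rwa [mul_assoc, one_div_mul_cancel hqa, mul_one] at h6
    have h4 : P (-(1 / a)) ^ 2 * a ^ 2 = P (-a) ^ 2 := by
      linear_combination (P (-(1 / a)) * -a - P (-a)) * h1
    simp only [hE, h5, ← h4]
    field_simp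
    ring
  have hUne : ∀ {w : ℂ}, w ∈ ({0}ᶜ : Set ℂ) → w ≠ 0 := fun h => h
  have hmA : ∀ w : ℂ, HasDerivAt (fun w : ℂ => w * a) a w := fun w => by
    simpa using (hasDerivAt_id w).mul_const a
  have hdA : ∀ w : ℂ, HasDerivAt (fun w : ℂ => w / a) (1 / a) w := fun w => by
    simpa using (hasDerivAt_id w).div_const a
  have hDder : ∀ w, w ≠ 0 → HasDerivAt D (deriv P (w * a) * a * P (w / a)
      + P (w * a) * (deriv P (w / a) * (1 / a))) w := fun w hw => by
    have h1 : HasDerivAt (fun w => P (w * a)) (deriv P (w * a) * a) w :=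
      HasDerivAt.comp (h₂ := P) (h := fun w => w * a) w (hdiff (mul_ne_zero hw ha)).hasDerivAt
        (hmA w)
    have h2 : HasDerivAt (fun w => P (w / a)) (deriv P (w / a) * (1 / a)) w :=
      HasDerivAt.comp (h₂ := P) (h := fun w => w / a) w (hdiff (div_ne_zero hw ha)).hasDerivAt
        (hdA w)
    exact h1.mul h2
  have hDdiff : DifferentiableOn ℂ D {0}ᶜ := fun w hw =>
    (hDder w hw).differentiableAt.differentiableWithinAt
  have hEdiff : DifferentiableOn ℂ E {0}ᶜ := by
    intro w hw
    have h1 : DifferentiableAt ℂ (fun w => P (-w)) w :=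
      (hdiff (neg_ne_zero.2 hw)).comp w (f := fun w => -w) (by fun_prop)
    have h2 : DifferentiableAt ℂ (fun w => P (-(q * w))) w :=
      (hdiff (neg_ne_zero.2 (mul_ne_zero hq0 hw))).comp w (f := fun w => -(q * w)) (by fun_prop)
    refine DifferentiableAt.differentiableWithinAt ?_
    exact (((h1.pow 2).mul_const _).mul_const _).sub
      (((h2.pow 2).const_mul _).mul differentiableAt_id)
  have hsimple : ∀ w ∈ ({0}ᶜ : Set ℂ), D w = 0 → E w = 0 ∧ deriv D w ≠ 0 := by
    intro w hw h0
    have hwa := mul_ne_zero (hUne hw) ha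
    have hwd := div_ne_zero (hUne hw) ha
    -- Genericity of `a` keeps the zeros of the two factors of `D` apart, so all zeros of `D` are
    -- simple.
    have key : ∀ m n : ℤ, w * a = (q ^ 2) ^ m → w / a = (q ^ 2) ^ n → False := by
      intro m n hm hn
      refine hgen (m - n) ?_
      rw [zpow_sub₀ hp0, ← hm, ← hn]
      field_simp [hUne hw]
    rw [(hDder w hw).deriv]
    rcases mul_eq_zero.1 h0 with h1 | h1
    · obtain ⟨m, hm⟩ := exists_of_thetaProd_eq_zero hp0 hp hwa h1
      have h2 : P (w / a) ≠ 0 := fun h => by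
        obtain ⟨n, hn⟩ := exists_of_thetaProd_eq_zero hp0 hp hwd h
        exact key m n hm hn
      refine ⟨?_, ?_⟩
      · rw [show w = (q ^ 2) ^ m * (1 / a) by rw [← hm]; field_simp]
        exact (hEiter m (one_div_ne_zero ha)).2 hEainv
      · rw [h1, zero_mul, add_zero]
        exact mul_ne_zero (mul_ne_zero (deriv_thetaProd_ne_zero hp0 hp hwa h1) ha) h2
    · obtain ⟨n, hn⟩ := exists_of_thetaProd_eq_zero hp0 hp hwd h1
      have h2 : P (w * a) ≠ 0 := fun h => by
        obtain ⟨m, hm⟩ := exists_of_thetaProd_eq_zero hp0 hp hwa h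
        exact key m n hm hn
      refine ⟨?_, ?_⟩
      · rw [show w = (q ^ 2) ^ n * a by rw [← hn]; field_simp]
        exact (hEiter n ha).2 hEa
      · rw [h1, mul_zero, zero_add]
        exact mul_ne_zero h2 (mul_ne_zero (deriv_thetaProd_ne_zero hp0 hp hwd h1)
          (one_div_ne_zero ha))
  obtain ⟨G, hGd, hG⟩ := exists_differentiableOn_eq_mul isOpen_compl_singleton hEdiff hDdiff hsimple
  have hGat : ∀ {w}, w ≠ 0 → DifferentiableAt ℂ G w := fun hw =>
    hGd.differentiableAt (isOpen_compl_singleton.mem_nhds hw)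
  have hGinv : ∀ w, w ≠ 0 → G (q ^ 2 * w) = G w := by
    intro w hw
    have hoff : ∀ x, x ≠ 0 → D x ≠ 0 → G (q ^ 2 * x) = G x := by
      intro x hx hDx
      have h1 := hG _ (show q ^ 2 * x ∈ ({0}ᶜ : Set ℂ) from mul_ne_zero hp0 hx)
      have h2 := hG x hx
      refine mul_right_cancel₀ hDx ?_
      rw [← h2, ← hDmul x hx, ← mul_assoc, ← h1, hEmul x hx]
    -- Where `D` vanishes it cannot be cancelled; as its zeros are isolated, invariance extends by
    -- continuity.
    by_cases hDw : D w = 0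
    · have hne := (hDder w hw).differentiableAt.hasDerivAt.eventually_ne (c := 0)
        (hsimple w hw hDw).2
      have hcont : ContinuousAt (fun x => G (q ^ 2 * x) - G x) w :=
        ((hGat (mul_ne_zero hp0 hw)).continuousAt.comp (f := fun x => q ^ 2 * x)
          (by fun_prop)).sub (hGat hw).continuousAt
      have hz : Tendsto (fun x => G (q ^ 2 * x) - G x) (𝓝[≠] w) (𝓝 0) := by
        refine tendsto_const_nhds.congr' ?_
        filter_upwards [hne, nhdsWithin_le_nhds (isOpen_compl_singleton.mem_nhds hw)] with x h1 h2
        rw [hoff x h2 h1, sub_self]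
      exact sub_eq_zero.1 (tendsto_nhds_unique (hcont.tendsto.mono_left nhdsWithin_le_nhds) hz)
    · exact hoff w hw hDw
  have hconst := eq_const_of_mul_invariant hp0 hp hGd hGinv hw (neg_ne_zero.2 one_ne_zero)
  have hPa : P (-a) ≠ 0 := fun h => by
    obtain ⟨m, hm⟩ := exists_of_thetaProd_eq_zero hp0 hp (neg_ne_zero.2 ha) h
    refine hgen (m * 2) ?_
    rw [zpow_mul, ← hm]
    norm_cast
    ring
  -- At w = -1 the first term of `E` contains `P 1` = 0, so the constant can be read off.
  have hval : G (-1) = a * P q ^ 2 := by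
    have h1 := hG (-1) (show (-1 : ℂ) ∈ ({0}ᶜ : Set ℂ) by simp)
    have h2 := hinv (neg_ne_zero.2 ha)
    have e0 : P 1 = 0 := thetaProd_one _ hp
    have e1 : -1 / a = 1 / -a := by rw [div_neg, neg_div]
    simp only [hE, hD, neg_neg, mul_neg, mul_one, neg_mul, one_mul, e0, e1] at h1
    refine mul_right_cancel₀ (pow_ne_zero 2 hPa) ?_
    have h3 : P (1 / -a) * a = P (-a) := by linear_combination -h2
    linear_combination -a * h1 - G (-1) * P (-a) * h3
  have hfin := hG w hw
  rw [hconst, hval] at hfin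
  exact hfin

/-! ### Real nome: zero-free regions and theta constants -/

lemma norm_ofReal_sq_lt_one {q : ℝ} (hq0 : 0 < q) (hq1 : q < 1) : ‖(q : ℂ) ^ 2‖ < 1 := by
  rw [norm_pow, Complex.norm_of_nonneg hq0.le]
  exact pow_lt_one₀ hq0.le hq1 two_ne_zero

lemma ofReal_sq_ne_zero {q : ℝ} (hq0 : 0 < q) : (q : ℂ) ^ 2 ≠ 0 :=
  pow_ne_zero 2 (Complex.ofReal_ne_zero.2 hq0.ne')

/-- The annulus q² < |x| ≤ 1 is a fundamental domain for x ↦ q²x, so 1 is the only power of q² in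
it. -/
lemma thetaProd_ne_zero {q : ℝ} (hq0 : 0 < q) (hq1 : q < 1) {x : ℂ} (h1 : q ^ 2 < ‖x‖)
    (h2 : ‖x‖ ≤ 1) (hx : x ≠ 1) : thetaProd ((q : ℂ) ^ 2) x ≠ 0 := by
  intro h
  have hx0 : x ≠ 0 := norm_pos_iff.1 ((by positivity : (0 : ℝ) < q ^ 2).trans h1)
  obtain ⟨m, rfl⟩ := exists_of_thetaProd_eq_zero (ofReal_sq_ne_zero hq0)
    (norm_ofReal_sq_lt_one hq0 hq1) hx0 h
  rw [norm_zpow, norm_pow, Complex.norm_of_nonneg hq0.le] at h1 h2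
  have hp1 : q ^ 2 < 1 := pow_lt_one₀ hq0.le hq1 two_ne_zero
  have hp0 : 0 < q ^ 2 := by positivity
  have e1 : m < 1 := by
    rw [← zpow_one (q ^ 2), ← zpow_mul, one_mul] at h1
    have h1' : (q ^ 2) ^ (1 : ℤ) < (q ^ 2) ^ m := by simpa using h1
    exact (zpow_lt_zpow_iff_right_of_lt_one₀ hp0 hp1).1 h1'
  have e2 : 0 ≤ m := by
    rw [← zpow_zero (q ^ 2)] at h2
    exact (zpow_le_zpow_iff_right_of_lt_one₀ hp0 hp1).1 h2
  obtain rfl : m = 0 := by omega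
  exact hx (zpow_zero _)

lemma thetaProd_ne_zero_of_one_lt {q : ℝ} (hq0 : 0 < q) (hq1 : q < 1) {x : ℂ} (h1 : 1 < ‖x‖)
    (h2 : q ^ 2 * ‖x‖ < 1) : thetaProd ((q : ℂ) ^ 2) x ≠ 0 := by
  intro h
  have hx0 : x ≠ 0 := norm_pos_iff.1 (zero_lt_one.trans h1)
  have h3 := thetaProd_mul (ofReal_sq_ne_zero hq0) (norm_ofReal_sq_lt_one hq0 hq1) hx0
  rw [h, neg_zero] at h3
  have hn : ‖(q : ℂ) ^ 2 * x‖ = q ^ 2 * ‖x‖ := by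
    rw [norm_mul, norm_pow, Complex.norm_of_nonneg hq0.le]
  refine thetaProd_ne_zero hq0 hq1 (x := (q : ℂ) ^ 2 * x) ?_ ?_ ?_
    ((mul_eq_zero.1 h3).resolve_right hx0)
  · rw [hn]
    exact lt_mul_of_one_lt_right (by positivity) h1
  · exact hn.trans_le h2.le
  · intro h4
    rw [h4, norm_one] at hn
    linarith

lemma thetaProd_self_ne_zero {q : ℝ} (hq0 : 0 < q) (hq1 : q < 1) :
    thetaProd ((q : ℂ) ^ 2) q ≠ 0 := by
  refine thetaProd_ne_zero hq0 hq1 ?_ ?_ ?_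
  · rw [Complex.norm_of_nonneg hq0.le]
    nlinarith
  · rw [Complex.norm_of_nonneg hq0.le]
    exact hq1.le
  · exact_mod_cast hq1.ne

lemma thetaProd_conj_sq {q : ℝ} (hq0 : 0 < q) (hq1 : q < 1) (w : ℂ) :
    thetaProd ((q : ℂ) ^ 2) ((starRingEnd ℂ) w) = (starRingEnd ℂ) (thetaProd ((q : ℂ) ^ 2) w) := by
  have h := norm_ofReal_sq_lt_one hq0 hq1
  rw [← Complex.ofReal_pow] at h ⊢
  exact thetaProd_conj h w

/-- The right side is the square of the real number q^m, whose square roots are real. Thus non-real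
parameters are generic. -/
lemma sq_ne_zpow_of_im_ne_zero (q : ℝ) {a : ℂ} (ha : a.im ≠ 0) (m : ℤ) :
    a ^ 2 ≠ ((q : ℂ) ^ 2) ^ m := by
  intro h
  have h1 : a ^ 2 = (((q ^ m) ^ 2 : ℝ) : ℂ) := by
    rw [h]
    push_cast
    rw [← zpow_natCast, ← zpow_natCast, ← zpow_mul, ← zpow_mul, mul_comm]
  push_cast at h1
  rcases sq_eq_sq_iff_eq_or_eq_neg.1 h1 with h | h <;> rw [h] at ha <;> norm_cast at ha

lemma thetaProd_three_term {q : ℝ} (hq0 : 0 < q) (hq1 : q < 1) {a w : ℂ} (ha : a.im ≠ 0)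
    (hw : w ≠ 0) :
    thetaProd ((q : ℂ) ^ 2) (-w) ^ 2 * thetaProd ((q : ℂ) ^ 2) (-(q * a)) ^ 2 * a
      - thetaProd ((q : ℂ) ^ 2) (-a) ^ 2 * thetaProd ((q : ℂ) ^ 2) (-(q * w)) ^ 2 * w
      = a * thetaProd ((q : ℂ) ^ 2) q ^ 2 *
        (thetaProd ((q : ℂ) ^ 2) (w * a) * thetaProd ((q : ℂ) ^ 2) (w / a)) :=
  thetaProd_three_term_of_generic (Complex.ofReal_ne_zero.2 hq0.ne')
    (by rwa [Complex.norm_of_nonneg hq0.le]) (fun h => ha (by simp [h])) hw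
    (sq_ne_zpow_of_im_ne_zero q ha)

/-- Jacobi's quartic identity for theta constants. -/
lemma thetaProd_quartic {q : ℝ} (hq0 : 0 < q) (hq1 : q < 1) :
    thetaProd ((q : ℂ) ^ 2) (-q) ^ 4 =
      q * thetaProd ((q : ℂ) ^ 2) (-1) ^ 4 + thetaProd ((q : ℂ) ^ 2) q ^ 4 := by
  have hp0 := ofReal_sq_ne_zero hq0
  have hp := norm_ofReal_sq_lt_one hq0 hq1
  have hqc : (q : ℂ) ≠ 0 := Complex.ofReal_ne_zero.2 hq0.ne'
  set P := thetaProd ((q : ℂ) ^ 2) with hP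
  have hcont : ∀ {x : ℂ}, x ≠ 0 → ContinuousAt P x :=
    fun hx => (differentiableAt_thetaProd hp hx).continuousAt
  -- The quartic identity is the three-term one at a = 1, w = 1/q. Since a = 1 is not generic, it is
  -- reached as a limit from the upper half-plane.
  set w : ℂ := 1 / q with hw
  have hw0 : w ≠ 0 := one_div_ne_zero hqc
  have hne : (𝓝[{a : ℂ | 0 < a.im}] (1 : ℂ)).NeBot := by
    rw [← mem_closure_iff_nhdsWithin_neBot, Complex.closure_setOfPred_lt_im]
    simp
  have hl : ContinuousAt (fun a : ℂ => P (-w) ^ 2 * P (-(q * a)) ^ 2 * a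
      - P (-a) ^ 2 * P (-(q * w)) ^ 2 * w) 1 := by
    have h1 : ContinuousAt (fun a => P (-(q * a))) 1 :=
      ContinuousAt.comp (g := P) (f := fun a : ℂ => -(q * a)) (hcont (by simpa using hqc))
        (by fun_prop)
    have h2 : ContinuousAt (fun a => P (-a)) 1 :=
      ContinuousAt.comp (g := P) (f := fun a : ℂ => -a) (hcont (by simp)) (by fun_prop)
    exact ((continuousAt_const.mul (h1.pow 2)).mul continuousAt_id).sub
      (((h2.pow 2).mul continuousAt_const).mul continuousAt_const)
  have hr : ContinuousAt (fun a : ℂ => a * P q ^ 2 * (P (w * a) * P (w / a))) 1 := by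
    have h1 : ContinuousAt (fun a => P (w * a)) 1 :=
      ContinuousAt.comp (g := P) (f := fun a : ℂ => w * a) (hcont (by simpa using hw0))
        (by fun_prop)
    have h2 : ContinuousAt (fun a => P (w / a)) 1 :=
      ContinuousAt.comp (g := P) (f := fun a : ℂ => w / a) (hcont (by simpa using hw0))
        (by fun_prop (disch := norm_num))
    exact (continuousAt_id.mul continuousAt_const).mul (h1.mul h2)
  have hlim := tendsto_nhds_unique_of_eventuallyEq
    (hl.tendsto.mono_left (nhdsWithin_le_nhds (s := {a : ℂ | 0 < a.im})))
    (hr.tendsto.mono_left nhdsWithin_le_nhds) (by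
      filter_upwards [self_mem_nhdsWithin] with a ha
      exact thetaProd_three_term hq0 hq1 (ne_of_gt ha) hw0)
  have e1 : P w * q = -P q := thetaProd_inv hp0 hp hqc
  have e2 : P (-w) * -q = -P (-q) := by
    have := thetaProd_inv hp0 hp (neg_ne_zero.2 hqc)
    rwa [one_div_neg_eq_neg_one_div] at this
  have e3 : (q : ℂ) * w = 1 := by rw [hw]; field_simp
  simp only [mul_one, div_one, one_mul, e3] at hlim
  linear_combination (q ^ 2 : ℂ) * hlim - P (-q) ^ 2 * (P (-w) * -q - P (-q)) * e2
    + P q ^ 2 * (P w * q - P q) * e1 + q * P (-1) ^ 4 * e3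

/-! ### The elliptic function of order two on the half annulus -/

/-- A quotient of squares of theta products, invariant under `w ↦ q² w` and `w ↦ 1 / w`, with a
double zero at `-1` and a double pole at `-1 / q`. -/
noncomputable def thetaQuot (q : ℝ) (w : ℂ) : ℂ :=
  thetaProd ((q : ℂ) ^ 2) (-w) ^ 2 / (w * thetaProd ((q : ℂ) ^ 2) (-(q * w)) ^ 2)

section

variable {q : ℝ}

lemma thetaQuot_conj (hq0 : 0 < q) (hq1 : q < 1) (w : ℂ) :
    thetaQuot q ((starRingEnd ℂ) w) = (starRingEnd ℂ) (thetaQuot q w) := by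
  simp only [thetaQuot, map_div₀, map_mul, map_pow, ← thetaProd_conj_sq hq0 hq1, map_neg,
    Complex.conj_ofReal]

lemma thetaQuot_mul (hq0 : 0 < q) (hq1 : q < 1) {w : ℂ} (hw : w ≠ 0) :
    thetaQuot q ((q : ℂ) ^ 2 * w) = thetaQuot q w := by
  have hp0 := ofReal_sq_ne_zero hq0
  have hp := norm_ofReal_sq_lt_one hq0 hq1
  have hqc : (q : ℂ) ≠ 0 := Complex.ofReal_ne_zero.2 hq0.ne'
  have h1 := thetaProd_mul hp0 hp (neg_ne_zero.2 hw)
  have h2 := thetaProd_mul hp0 hp (neg_ne_zero.2 (mul_ne_zero hqc hw))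
  rw [show (q : ℂ) ^ 2 * -w = -((q : ℂ) ^ 2 * w) by ring, mul_neg, neg_inj] at h1
  rw [show (q : ℂ) ^ 2 * -(q * w) = -(q * ((q : ℂ) ^ 2 * w)) by ring, mul_neg, neg_inj] at h2
  rw [thetaQuot, thetaQuot, ← h1, ← h2]
  field_simp

lemma thetaQuot_inv (hq0 : 0 < q) (hq1 : q < 1) {w : ℂ} (hw : w ≠ 0) :
    thetaQuot q (1 / w) = thetaQuot q w := by
  have hp0 := ofReal_sq_ne_zero hq0
  have hp := norm_ofReal_sq_lt_one hq0 hq1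
  have hqc : (q : ℂ) ≠ 0 := Complex.ofReal_ne_zero.2 hq0.ne'
  have hqw := neg_ne_zero.2 (mul_ne_zero hqc hw)
  have h1 := thetaProd_inv hp0 hp (neg_ne_zero.2 hw)
  have h2 := thetaProd_inv hp0 hp hqw
  have h3 := thetaProd_mul hp0 hp (one_div_ne_zero hqw)
  rw [one_div_neg_eq_neg_one_div, mul_neg, neg_inj] at h1
  rw [show (q : ℂ) ^ 2 * (1 / -(q * w)) = -(q * (1 / w)) by field_simp] at h3
  have h4 : thetaProd ((q : ℂ) ^ 2) (-(q * (1 / w))) = thetaProd ((q : ℂ) ^ 2) (-(q * w)) := by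
    have h6 : thetaProd ((q : ℂ) ^ 2) (-(q * (1 / w))) * (1 / -(q * w)) * -(q * w)
        = thetaProd ((q : ℂ) ^ 2) (-(q * w)) := by
      rw [h3]
      linear_combination -h2
    rwa [mul_assoc, one_div_mul_cancel hqw, mul_one] at h6
  rw [thetaQuot, thetaQuot, ← h1, h4]
  field_simp

/-- Cross-multiplied, equality of the two values says that the left side of the three-term identity
vanishes; the prefactor on its right side does not. -/
lemma thetaProd_mul_eq_zero_of_thetaQuot_eq (hq0 : 0 < q) (hq1 : q < 1) {a w : ℂ} (ha : a.im ≠ 0)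
    (hw : w ≠ 0) (ha' : thetaProd ((q : ℂ) ^ 2) (-(q * a)) ≠ 0)
    (hw' : thetaProd ((q : ℂ) ^ 2) (-(q * w)) ≠ 0) (h : thetaQuot q w = thetaQuot q a) :
    thetaProd ((q : ℂ) ^ 2) (w * a) * thetaProd ((q : ℂ) ^ 2) (w / a) = 0 := by
  have ha0 : a ≠ 0 := fun h => ha (by simp [h])
  have hqn := thetaProd_self_ne_zero hq0 hq1
  have h3 := thetaProd_three_term hq0 hq1 ha hw
  rw [thetaQuot, thetaQuot, div_eq_div_iff (mul_ne_zero hw (pow_ne_zero 2 hw'))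
    (mul_ne_zero ha0 (pow_ne_zero 2 ha'))] at h
  refine (mul_eq_zero.1 (?_ : a * thetaProd ((q : ℂ) ^ 2) q ^ 2 * _ = 0)).resolve_left
    (mul_ne_zero ha0 (pow_ne_zero 2 hqn))
  rw [← h3]
  linear_combination h

lemma thetaProd_neg_mul_ne_zero (hq0 : 0 < q) (hq1 : q < 1) {w : ℂ} (h1 : 1 ≤ ‖w‖)
    (h2 : q * ‖w‖ ≤ 1) (h3 : -(q * w) ≠ 1) : thetaProd ((q : ℂ) ^ 2) (-(q * w)) ≠ 0 := by
  have hn : ‖-(q * w)‖ = q * ‖w‖ := by rw [norm_neg, norm_mul, Complex.norm_of_nonneg hq0.le]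
  refine thetaProd_ne_zero hq0 hq1 ?_ (hn.trans_le h2) h3
  rw [hn]
  nlinarith

lemma neg_ofReal_mul_ne_one_of_lt (hq0 : 0 < q) {w : ℂ} (h2 : q * ‖w‖ < 1) : -(q * w) ≠ 1 := by
  intro h
  have := congrArg norm h
  rw [norm_neg, norm_mul, Complex.norm_of_nonneg hq0.le, norm_one] at this
  linarith

lemma thetaQuot_injOn (hq0 : 0 < q) (hq1 : q < 1) :
    InjOn (thetaQuot q) {w | 0 < w.im ∧ 1 < ‖w‖ ∧ q * ‖w‖ < 1} := by
  rintro w ⟨hw1, hw2, hw3⟩ a ⟨ha1, ha2, ha3⟩ h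
  have hw0 : w ≠ 0 := fun h => by simp [h] at hw1
  have ha0 : a ≠ 0 := fun h => by simp [h] at ha1
  have hz := thetaProd_mul_eq_zero_of_thetaQuot_eq hq0 hq1 ha1.ne' hw0
    (thetaProd_neg_mul_ne_zero hq0 hq1 ha2.le ha3.le (neg_ofReal_mul_ne_one_of_lt hq0 ha3))
    (thetaProd_neg_mul_ne_zero hq0 hq1 hw2.le hw3.le (neg_ofReal_mul_ne_one_of_lt hq0 hw3)) h
  -- The modulus of `w * a` lies strictly between 1 and q⁻², a region without zeros. So w/a is the
  -- zero, and its modulus lies strictly between q and 1/q, which leaves only w = a.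
  have h1 : thetaProd ((q : ℂ) ^ 2) (w * a) ≠ 0 := by
    refine thetaProd_ne_zero_of_one_lt hq0 hq1 ?_ ?_ <;> rw [norm_mul]
    · nlinarith
    · calc q ^ 2 * (‖w‖ * ‖a‖) = (q * ‖w‖) * (q * ‖a‖) := by ring
        _ < 1 := mul_lt_one_of_nonneg_of_lt_one_left (by positivity) hw3 ha3.le
  have key : ∀ {x y : ℂ}, x ≠ 0 → y ≠ 0 → 1 < ‖x‖ → q * ‖y‖ < 1 → ‖x‖ ≤ ‖y‖ →
      thetaProd ((q : ℂ) ^ 2) (x / y) = 0 → x = y := by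
    intro x y hx hy hx1 hy1 hxy hxy0
    by_contra hne
    refine thetaProd_ne_zero hq0 hq1 ?_ ?_ ?_ hxy0
    · rw [norm_div, lt_div_iff₀ (norm_pos_iff.2 hy)]
      nlinarith [norm_nonneg y]
    · rw [norm_div]
      exact div_le_one_of_le₀ hxy (norm_nonneg _)
    · rwa [ne_eq, div_eq_one_iff_eq hy]
  have h2 := (mul_eq_zero.1 hz).resolve_left h1
  rcases le_total ‖w‖ ‖a‖ with hle | hle
  · exact key hw0 ha0 hw2 ha3 hle h2
  · refine (key ha0 hw0 ha2 hw3 hle ?_).symm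
    have h3 := thetaProd_inv (ofReal_sq_ne_zero hq0) (norm_ofReal_sq_lt_one hq0 hq1)
      (div_ne_zero hw0 ha0)
    rw [h2, neg_zero, one_div_div] at h3
    exact (mul_eq_zero.1 h3).resolve_right (div_ne_zero hw0 ha0)

/-- The three-term identity is applied to `w` and its conjugate: the product of the two has modulus
strictly between 1 and q⁻², and their ratio has modulus 1 without being 1. -/
lemma thetaQuot_conj_ne (hq0 : 0 < q) (hq1 : q < 1) {w : ℂ} (hw1 : 0 < w.im) (hw2 : 1 < ‖w‖)
    (hw3 : q * ‖w‖ < 1) : thetaQuot q ((starRingEnd ℂ) w) ≠ thetaQuot q w := by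
  intro h
  have hw0 : w ≠ 0 := fun h => by simp [h] at hw1
  have hn : ‖(starRingEnd ℂ) w‖ = ‖w‖ := Complex.norm_conj w
  have hz := thetaProd_mul_eq_zero_of_thetaQuot_eq hq0 hq1 hw1.ne'
    (by simpa using hw0)
    (thetaProd_neg_mul_ne_zero hq0 hq1 hw2.le hw3.le (neg_ofReal_mul_ne_one_of_lt hq0 hw3))
    (thetaProd_neg_mul_ne_zero hq0 hq1 (hw2.le.trans_eq hn.symm) (by rw [hn]; exact hw3.le)
      (neg_ofReal_mul_ne_one_of_lt hq0 (by rwa [hn]))) h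
  rcases mul_eq_zero.1 hz with h1 | h1
  · refine thetaProd_ne_zero_of_one_lt hq0 hq1 ?_ ?_ h1 <;> rw [norm_mul, hn]
    · nlinarith
    · calc q ^ 2 * (‖w‖ * ‖w‖) = (q * ‖w‖) * (q * ‖w‖) := by ring
        _ < 1 := mul_lt_one_of_nonneg_of_lt_one_left (by positivity) hw3 hw3.le
  · have hone : ‖(starRingEnd ℂ) w / w‖ = 1 := by
      rw [norm_div, hn, div_self (norm_ne_zero_iff.2 hw0)]
    refine thetaProd_ne_zero hq0 hq1 ?_ hone.le ?_ h1
    · rw [hone]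
      exact pow_lt_one₀ hq0.le hq1 two_ne_zero
    · rw [ne_eq, div_eq_one_iff_eq hw0]
      intro h2
      have := congrArg Complex.im h2
      simp at this
      linarith

lemma differentiableAt_thetaQuot (hq0 : 0 < q) (hq1 : q < 1) {w : ℂ} (hw : w ≠ 0)
    (hw' : thetaProd ((q : ℂ) ^ 2) (-(q * w)) ≠ 0) : DifferentiableAt ℂ (thetaQuot q) w := by
  have hp := norm_ofReal_sq_lt_one hq0 hq1
  have hqc : (q : ℂ) ≠ 0 := Complex.ofReal_ne_zero.2 hq0.ne'
  have h1 : DifferentiableAt ℂ (fun w => thetaProd ((q : ℂ) ^ 2) (-w)) w :=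
    DifferentiableAt.comp (g := thetaProd ((q : ℂ) ^ 2)) (f := fun w => -w) w
      (differentiableAt_thetaProd hp (neg_ne_zero.2 hw)) (by fun_prop)
  have h2 : DifferentiableAt ℂ (fun w => thetaProd ((q : ℂ) ^ 2) (-(q * w))) w :=
    DifferentiableAt.comp (g := thetaProd ((q : ℂ) ^ 2)) (f := fun w : ℂ => -(q * w)) w
      (differentiableAt_thetaProd hp (neg_ne_zero.2 (mul_ne_zero hqc hw))) (by fun_prop)
  exact (h1.pow 2).div (differentiableAt_id.mul (h2.pow 2)) (mul_ne_zero hw (pow_ne_zero 2 hw'))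

end

/-! ### The corner position as a function of the nome -/

/-- The ratio `∏ (1 - q²ⁿ⁺¹) / ∏ (1 + q²ⁿ⁺²)`. -/
noncomputable def nomeRatio (q : ℝ) : ℝ :=
  ‖qProd ((q : ℂ) ^ 2) q‖ / ‖qProd ((q : ℂ) ^ 2) (-(q : ℂ) ^ 2)‖

/-- The position of the fourth corner as a function of the nome `q`. -/
noncomputable def cornerOfNome (q : ℝ) : ℝ := 1 + nomeRatio q ^ 8 / (16 * q)

section

variable {q : ℝ}

lemma one_le_norm_qProd_neg_sq (hq0 : 0 < q) (hq1 : q < 1) :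
    1 ≤ ‖qProd ((q : ℂ) ^ 2) (-(q : ℂ) ^ 2)‖ := by
  have hp := norm_ofReal_sq_lt_one hq0 hq1
  have h := norm_qProd_le (w := 0) (w' := -(q : ℂ) ^ 2) hp hp fun n => by
    have h1 : (1 : ℂ) - ((q : ℂ) ^ 2) ^ n * -(q : ℂ) ^ 2 =
      ((1 + (q ^ 2) ^ n * q ^ 2 : ℝ) : ℂ) := by
      push_cast
      ring
    rw [h1, Complex.norm_of_nonneg (by positivity)]
    simp
    positivity
  simpa [qProd_zero_right] using h

lemma qProd_sq_self_ne_zero (hq0 : 0 < q) (hq1 : q < 1) : qProd ((q : ℂ) ^ 2) q ≠ 0 := by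
  intro h
  obtain ⟨n, hn⟩ := exists_of_qProd_eq_zero (norm_ofReal_sq_lt_one hq0 hq1) h
  have h1 : ((q : ℂ) ^ (2 * n + 1)) = 1 := by rw [← hn]; ring
  have h2 : q ^ (2 * n + 1) = 1 := by exact_mod_cast h1
  exact (pow_lt_one₀ hq0.le hq1 (by omega)).ne h2

lemma nomeRatio_pos (hq0 : 0 < q) (hq1 : q < 1) : 0 < nomeRatio q :=
  div_pos (norm_pos_iff.2 (qProd_sq_self_ne_zero hq0 hq1))
    (zero_lt_one.trans_le (one_le_norm_qProd_neg_sq hq0 hq1))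

lemma norm_one_sub_pow_mul (hq0 : 0 < q) (hq1 : q < 1) (n : ℕ) :
    ‖1 - ((q : ℂ) ^ 2) ^ n * q‖ = 1 - (q ^ 2) ^ n * q := by
  have h1 : (1 : ℂ) - ((q : ℂ) ^ 2) ^ n * q = ((1 - (q ^ 2) ^ n * q : ℝ) : ℂ) := by
    push_cast
    ring
  rw [h1, Complex.norm_of_nonneg]
  have : (q ^ 2) ^ n ≤ 1 := pow_le_one₀ (by positivity) (pow_le_one₀ hq0.le hq1.le)
  nlinarith

lemma norm_one_add_pow_mul (q : ℝ) (n : ℕ) :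
    ‖1 - ((q : ℂ) ^ 2) ^ n * -(q : ℂ) ^ 2‖ = 1 + (q ^ 2) ^ n * q ^ 2 := by
  have h1 : (1 : ℂ) - ((q : ℂ) ^ 2) ^ n * -(q : ℂ) ^ 2 = ((1 + (q ^ 2) ^ n * q ^ 2 : ℝ) : ℂ) := by
    push_cast
    ring
  rw [h1, Complex.norm_of_nonneg (by positivity)]

/-- As q grows, every factor of the numerator decreases and every factor of the denominator
increases. -/
lemma nomeRatio_anti {q' : ℝ} (hq0 : 0 < q) (h : q ≤ q') (hq1 : q' < 1) :
    nomeRatio q' ≤ nomeRatio q := by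
  have hp := norm_ofReal_sq_lt_one hq0 (h.trans_lt hq1)
  have hp' := norm_ofReal_sq_lt_one (hq0.trans_le h) hq1
  refine div_le_div₀ (norm_nonneg _) ?_
    (zero_lt_one.trans_le (one_le_norm_qProd_neg_sq hq0 (h.trans_lt hq1))) ?_
  · refine norm_qProd_le hp' hp fun n => ?_
    rw [norm_one_sub_pow_mul hq0 (h.trans_lt hq1), norm_one_sub_pow_mul (hq0.trans_le h) hq1]
    gcongr
  · refine norm_qProd_le hp hp' fun n => ?_
    rw [norm_one_add_pow_mul, norm_one_add_pow_mul]
    gcongr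

/-- Only the first factor of the numerator is kept. The bound forces the corner position towards 1
as q → 1. -/
lemma nomeRatio_le (hq0 : 0 < q) (hq1 : q < 1) : nomeRatio q ≤ 1 - q := by
  have hp := norm_ofReal_sq_lt_one hq0 hq1
  have h1 : ‖qProd ((q : ℂ) ^ 2) ((q : ℂ) ^ 2 * q)‖ ≤ 1 := by
    have := norm_qProd_le (w := (q : ℂ) ^ 2 * q) (w' := 0) hp hp fun n => by
      rw [← mul_assoc, ← pow_succ, norm_one_sub_pow_mul hq0 hq1]
      simp
      positivity
    simpa [qProd_zero_right] using this
  have h2 : ‖(1 : ℂ) - q‖ = 1 - q := by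
    have := norm_one_sub_pow_mul hq0 hq1 0
    simpa using this
  refine (div_le_self (norm_nonneg _) (one_le_norm_qProd_neg_sq hq0 hq1)).trans ?_
  rw [qProd_eq_mul hp, norm_mul, h2]
  exact mul_le_of_le_one_right (by linarith) h1

/-- The value q₀ = 0 is allowed on purpose: the limit there produces the constant 1/16 of the
asymptotics. -/
lemma tendsto_nomeRatio {q₀ : ℝ} (h0 : 0 ≤ q₀) (h1 : q₀ < 1)
    (hne : qProd ((q₀ : ℂ) ^ 2) (-(q₀ : ℂ) ^ 2) ≠ 0) :
    Tendsto nomeRatio (𝓝 q₀) (𝓝 (nomeRatio q₀)) := by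
  have hp : ‖(q₀ : ℂ) ^ 2‖ < 1 := by
    rw [norm_pow, Complex.norm_of_nonneg h0]
    exact pow_lt_one₀ h0 h1 two_ne_zero
  have hc : Tendsto (fun q : ℝ => (q : ℂ)) (𝓝 q₀) (𝓝 q₀) :=
    Complex.continuous_ofReal.continuousAt
  exact (tendsto_qProd hp (hc.pow 2) hc).norm.div
    (tendsto_qProd hp (hc.pow 2) (hc.pow 2).neg).norm (norm_ne_zero_iff.2 hne)

lemma nomeRatio_zero : nomeRatio 0 = 1 := by simp [nomeRatio, qProd_zero_right]

lemma one_lt_cornerOfNome (hq0 : 0 < q) (hq1 : q < 1) : 1 < cornerOfNome q := by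
  have := nomeRatio_pos hq0 hq1
  rw [cornerOfNome]
  linarith [div_pos (pow_pos this 8) (by positivity : 0 < 16 * q)]

lemma cornerOfNome_strictAntiOn : StrictAntiOn cornerOfNome (Ioo 0 1) := by
  rintro q ⟨hq0, hq1⟩ q' ⟨hq0', hq1'⟩ h
  have h1 := nomeRatio_anti hq0 h.le hq1'
  have h2 := nomeRatio_pos hq0' hq1'
  have h3 : nomeRatio q' ^ 8 ≤ nomeRatio q ^ 8 := pow_le_pow_left₀ h2.le h1 8
  have h4 : nomeRatio q' ^ 8 / (16 * q') < nomeRatio q ^ 8 / (16 * q) :=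
    div_lt_div₀' h3 (by linarith) (pow_pos (h2.trans_le h1) 8) (by positivity)
  rw [cornerOfNome, cornerOfNome]
  linarith

lemma continuousOn_cornerOfNome : ContinuousOn cornerOfNome (Ioo 0 1) := by
  rintro q ⟨hq0, hq1⟩
  have hne := norm_pos_iff.1 (zero_lt_one.trans_le (one_le_norm_qProd_neg_sq hq0 hq1))
  have h1 : ContinuousAt nomeRatio q := tendsto_nomeRatio hq0.le hq1 hne
  exact (continuousAt_const.add ((h1.pow 8).div (continuousAt_const.mul continuousAt_id)
    (mul_ne_zero (by norm_num) hq0.ne'))).continuousWithinAt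

lemma tendsto_cornerOfNome_mul :
    Tendsto (fun q => cornerOfNome q * q) (𝓝[>] 0) (𝓝 (1 / 16)) := by
  have h1 : Tendsto nomeRatio (𝓝 0) (𝓝 1) := by
    simpa only [nomeRatio_zero] using tendsto_nomeRatio le_rfl zero_lt_one (by
      simp [qProd_zero_right])
  have h2 : Tendsto (fun q : ℝ => q + nomeRatio q ^ 8 / 16) (𝓝 0) (𝓝 (0 + 1 ^ 8 / 16)) :=
    tendsto_id.add ((h1.pow 8).div_const 16)
  rw [zero_add, one_pow] at h2
  refine (h2.mono_left nhdsWithin_le_nhds).congr' ?_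
  filter_upwards [self_mem_nhdsWithin] with q hq
  have : q ≠ 0 := ne_of_gt hq
  rw [cornerOfNome]
  field_simp

lemma cornerOfNome_surjOn : SurjOn cornerOfNome (Ioo 0 1) (Ioi 1) := by
  intro y hy
  have hlow : ∃ q ∈ Ioo (0 : ℝ) 1, cornerOfNome q ≤ y := by
    have h1 : Tendsto (fun q : ℝ => 1 + (1 - q) ^ 8 / (16 * q)) (𝓝[<] 1)
        (𝓝 (1 + (1 - 1) ^ 8 / (16 * 1))) := by
      have : ContinuousAt (fun q : ℝ => 1 + (1 - q) ^ 8 / (16 * q)) 1 := by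
        fun_prop (disch := norm_num)
      exact this.tendsto.mono_left nhdsWithin_le_nhds
    have h2 := h1.eventually_lt_const (u := y) (by simpa using hy)
    have h3 : Ioo (0 : ℝ) 1 ∈ 𝓝[<] 1 := Ioo_mem_nhdsLT zero_lt_one
    obtain ⟨q, hq, hq0, hq1⟩ := (h2.and h3).exists
    refine ⟨q, ⟨hq0, hq1⟩, le_trans ?_ hq.le⟩
    rw [cornerOfNome]
    have := nomeRatio_le hq0 hq1
    have := (nomeRatio_pos hq0 hq1).le
    gcongr
  have hhigh : ∃ q ∈ Ioo (0 : ℝ) 1, y ≤ cornerOfNome q := by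
    have h1 : Tendsto (fun q => y * q) (𝓝[>] 0) (𝓝 0) := by
      have : ContinuousAt (fun q => y * q) 0 := by fun_prop
      simpa using this.tendsto.mono_left nhdsWithin_le_nhds
    have h2 := h1.eventually_lt tendsto_cornerOfNome_mul (by norm_num)
    have h3 : Ioo (0 : ℝ) 1 ∈ 𝓝[>] 0 := Ioo_mem_nhdsGT zero_lt_one
    obtain ⟨q, hq, hq0, hq1⟩ := (h2.and h3).exists
    exact ⟨q, ⟨hq0, hq1⟩, (lt_of_mul_lt_mul_right hq hq0.le).le⟩
  obtain ⟨a, ha, hay⟩ := hlow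
  obtain ⟨b, hb, hby⟩ := hhigh
  exact isPreconnected_Ioo.intermediate_value ha hb continuousOn_cornerOfNome ⟨hay, hby⟩

/-- The corner position in terms of theta constants. -/
lemma cornerOfNome_eq (hq0 : 0 < q) (hq1 : q < 1) :
    (cornerOfNome q : ℂ) = thetaProd ((q : ℂ) ^ 2) (-q) ^ 4 /
      (q * thetaProd ((q : ℂ) ^ 2) (-1) ^ 4) := by
  have hp := norm_ofReal_sq_lt_one hq0 hq1
  have hqc : (q : ℂ) ≠ 0 := Complex.ofReal_ne_zero.2 hq0.ne'
  -- The product is real at real points, so an even power of its norm is the same power of the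
  -- product, whatever its sign.
  have hpow : ∀ x : ℝ, ((‖qProd ((q : ℂ) ^ 2) x‖ : ℝ) : ℂ) ^ 8 = qProd ((q : ℂ) ^ 2) x ^ 8 := by
    intro x
    have h1 : (starRingEnd ℂ) (qProd ((q : ℂ) ^ 2) x) = qProd ((q : ℂ) ^ 2) x := by
      have := qProd_conj (p := q ^ 2) (by push_cast; exact hp) x
      push_cast at this
      rw [← this, Complex.conj_ofReal]
    have h2 := Complex.conj_mul' (qProd ((q : ℂ) ^ 2) x)
    rw [h1] at h2
    calc _ = (((‖qProd ((q : ℂ) ^ 2) x‖ : ℝ) : ℂ) ^ 2) ^ 4 := by ring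
      _ = _ := by rw [← h2]; ring
  have h1 := hpow q
  have h2 := hpow (-q ^ 2)
  push_cast at h2
  have h3 : thetaProd ((q : ℂ) ^ 2) q = qProd ((q : ℂ) ^ 2) q ^ 2 := by
    rw [thetaProd, pow_two (q : ℂ), mul_div_assoc, div_self hqc, mul_one, pow_two (qProd _ _)]
  -- The factor 2 is 1 - w at w = -1; its fourth power is the 16 in `cornerOfNome`.
  have h4 : thetaProd ((q : ℂ) ^ 2) (-1) = 2 * qProd ((q : ℂ) ^ 2) (-(q : ℂ) ^ 2) ^ 2 := by
    rw [thetaProd, qProd_eq_mul hp (-1), div_neg, div_one, mul_neg_one]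
    ring
  have hB := norm_pos_iff.1 (zero_lt_one.trans_le (one_le_norm_qProd_neg_sq hq0 hq1))
  rw [thetaProd_quartic hq0 hq1, h3, h4, cornerOfNome, nomeRatio]
  push_cast
  rw [div_pow, h1, h2]
  field_simp
  ring

end

/-! ### Dependence of the corner position on the length -/

/-- The position `ρ(L)` of the image of the corner `L`. -/
noncomputable def cornerPos (L : ℝ) : ℝ := cornerOfNome (Real.exp (-L))

lemma exp_neg_mem_Ioo {L : ℝ} (hL : 0 < L) : Real.exp (-L) ∈ Ioo (0 : ℝ) 1 :=
  ⟨Real.exp_pos _, by simpa using hL⟩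

lemma one_lt_cornerPos {L : ℝ} (hL : 0 < L) : 1 < cornerPos L :=
  one_lt_cornerOfNome (exp_neg_mem_Ioo hL).1 (exp_neg_mem_Ioo hL).2

lemma cornerPos_strictMonoOn : StrictMonoOn cornerPos (Ioi 0) := fun _ ha _ hb h =>
  cornerOfNome_strictAntiOn (exp_neg_mem_Ioo hb) (exp_neg_mem_Ioo ha)
    (Real.exp_lt_exp.2 (neg_lt_neg h))

lemma cornerPos_surjOn : SurjOn cornerPos (Ioi 0) (Ioi 1) := by
  intro y hy
  obtain ⟨q, hq, rfl⟩ := cornerOfNome_surjOn hy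
  refine ⟨-Real.log q, neg_pos.2 (Real.log_neg hq.1 hq.2), ?_⟩
  rw [cornerPos, neg_neg, Real.exp_log hq.1]

lemma exists_inverse_cornerPos : ∃ ℓ : ℝ → ℝ, StrictMonoOn ℓ (Ioi 1) ∧
    MapsTo ℓ (Ioi 1) (Ioi 0) ∧ InvOn ℓ cornerPos (Ioi 0) (Ioi 1) := by
  have hmaps := cornerPos_surjOn.mapsTo_invFunOn
  have hinv := cornerPos_surjOn.rightInvOn_invFunOn
  refine ⟨Function.invFunOn cornerPos (Ioi 0), fun a ha b hb hab => ?_, hmaps,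
    cornerPos_strictMonoOn.injOn.leftInvOn_invFunOn, hinv⟩
  rw [← cornerPos_strictMonoOn.lt_iff_lt (hmaps ha) (hmaps hb), hinv ha, hinv hb]
  exact hab

/-- The difference in fact converges to log 16, being minus the logarithm of ρq with q = e^{-L}. -/
lemma isBigO_sub_log_cornerPos :
    (fun L : ℝ => L - Real.log (cornerPos L)) =O[atTop] (fun _ => (1 : ℝ)) := by
  have h1 : Tendsto (fun L : ℝ => Real.exp (-L)) atTop (𝓝[>] 0) :=
    tendsto_nhdsWithin_iff.2 ⟨Real.tendsto_exp_neg_atTop_nhds_zero,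
      .of_forall fun _ => Real.exp_pos _⟩
  have h2 := ((tendsto_cornerOfNome_mul.comp h1).log (by norm_num)).neg
  refine (h2.congr' ?_).isBigO_one ℝ
  filter_upwards [eventually_gt_atTop 0] with L hL
  have h3 := one_lt_cornerPos hL
  rw [cornerPos] at h3
  simp only [Function.comp_apply]
  rw [Real.log_mul (by linarith) (Real.exp_pos _).ne', Real.log_exp, cornerPos]
  ring

/-! ### The map of the rectangle with the first normalization -/

/-- The conformal map of the rectangle `(0, L) × (0, iπ)` onto the upper half-plane, as a
quotient of theta products in `exp z`. -/
noncomputable def rectMap (L : ℝ) (z : ℂ) : ℂ :=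
  thetaQuot (Real.exp (-L)) (Complex.exp z) / thetaQuot (Real.exp (-L)) 1

lemma mem_openRect {L : ℝ} {z : ℂ} :
    z ∈ openRect L ↔ (0 < z.re ∧ z.re < L) ∧ 0 < z.im ∧ z.im < π := Iff.rfl

lemma isOpen_openRect (L : ℝ) : IsOpen (openRect L) := isOpen_Ioo.reProdIm isOpen_Ioo

lemma isBounded_openRect (L : ℝ) : Bornology.IsBounded (openRect L) :=
  (Metric.isBounded_Ioo 0 L).reProdIm (Metric.isBounded_Ioo 0 π)

lemma isPreconnected_openRect (L : ℝ) : IsPreconnected (openRect L) :=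
  (((convex_Ioo 0 L).linear_preimage Complex.reLm).inter
    ((convex_Ioo 0 π).linear_preimage Complex.imLm)).isPreconnected

section

variable {L : ℝ}

lemma mem_closure_openRect (hL : 0 < L) {z : ℂ} :
    z ∈ closure (openRect L) ↔ (0 ≤ z.re ∧ z.re ≤ L) ∧ 0 ≤ z.im ∧ z.im ≤ π := by
  rw [openRect, Complex.closure_reProdIm, closure_Ioo hL.ne, closure_Ioo pi_pos.ne]
  exact Iff.rfl

lemma zero_mem_closure_openRect (hL : 0 < L) : (0 : ℂ) ∈ closure (openRect L) := by
  simp [mem_closure_openRect hL, hL.le, pi_pos.le]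

lemma ofReal_mem_closure_openRect (hL : 0 < L) : (L : ℂ) ∈ closure (openRect L) := by
  simp [mem_closure_openRect hL, hL.le, pi_pos.le]

lemma pi_mul_I_mem_closure_openRect (hL : 0 < L) : (π * Complex.I : ℂ) ∈ closure (openRect L) := by
  simp [mem_closure_openRect hL, hL.le, pi_pos.le]

lemma add_pi_mul_I_mem_closure_openRect (hL : 0 < L) :
    (L + π * Complex.I : ℂ) ∈ closure (openRect L) := by
  simp [mem_closure_openRect hL, hL.le, pi_pos.le]

lemma exp_neg_mul_norm_exp (L : ℝ) (z : ℂ) :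
    Real.exp (-L) * ‖Complex.exp z‖ = Real.exp (z.re - L) := by
  rw [Complex.norm_exp, ← Real.exp_add]
  ring_nf

lemma neg_exp_mul_exp_ne_one (hL : 0 < L) {z : ℂ} (hz : z ∈ closure (openRect L))
    (hc : z ≠ L + π * Complex.I) : -((Real.exp (-L) : ℝ) * Complex.exp z) ≠ 1 := by
  obtain ⟨-, h3, h4⟩ := (mem_closure_openRect hL).1 hz
  intro h
  refine hc (Complex.exp_inj_of_neg_pi_lt_of_le_pi (by linarith [pi_pos]) h4 (by simp [pi_pos])
    (by simp) ?_)
  have h1 : Complex.exp (-L) * Complex.exp L = 1 := by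
    rw [← Complex.exp_add, neg_add_cancel, Complex.exp_zero]
  push_cast at h
  rw [Complex.exp_add, Complex.exp_pi_mul_I]
  linear_combination -Complex.exp L * h - Complex.exp z * h1

lemma thetaProd_exp_ne_zero (hL : 0 < L) {z : ℂ} (hz : z ∈ closure (openRect L))
    (hc : z ≠ L + π * Complex.I) :
    thetaProd (((Real.exp (-L) : ℝ) : ℂ) ^ 2) (-((Real.exp (-L) : ℝ) * Complex.exp z)) ≠ 0 := by
  obtain ⟨⟨h1, h2⟩, -⟩ := (mem_closure_openRect hL).1 hz
  have hq := exp_neg_mem_Ioo hL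
  refine thetaProd_neg_mul_ne_zero hq.1 hq.2 ?_ ?_ (neg_exp_mul_exp_ne_one hL hz hc)
  · rw [Complex.norm_exp]
    exact Real.one_le_exp h1
  · rw [exp_neg_mul_norm_exp]
    exact Real.exp_le_one_iff.2 (by linarith)

lemma differentiableAt_rectMap (hL : 0 < L) {z : ℂ} (hz : z ∈ closure (openRect L))
    (hc : z ≠ L + π * Complex.I) : DifferentiableAt ℂ (rectMap L) z := by
  have hq := exp_neg_mem_Ioo hL
  exact ((differentiableAt_thetaQuot hq.1 hq.2 (Complex.exp_ne_zero z)
    (thetaProd_exp_ne_zero hL hz hc)).comp z Complex.differentiable_exp.differentiableAt).div_const _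

lemma thetaProd_neg_one_ne_zero {q : ℝ} (hq0 : 0 < q) (hq1 : q < 1) :
    thetaProd ((q : ℂ) ^ 2) (-1) ≠ 0 :=
  thetaProd_ne_zero hq0 hq1 (by simpa using pow_lt_one₀ hq0.le hq1 two_ne_zero) (by simp)
    (by norm_num)

lemma thetaProd_neg_ne_zero {q : ℝ} (hq0 : 0 < q) (hq1 : q < 1) :
    thetaProd ((q : ℂ) ^ 2) (-q) ≠ 0 := by
  have := thetaProd_neg_mul_ne_zero hq0 hq1 (w := 1) (by simp) (by simpa using hq1.le)
    (neg_ofReal_mul_ne_one_of_lt hq0 (by simpa using hq1))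
  rwa [mul_one] at this

lemma thetaQuot_one (q : ℝ) : thetaQuot q 1 =
    thetaProd ((q : ℂ) ^ 2) (-1) ^ 2 / thetaProd ((q : ℂ) ^ 2) (-q) ^ 2 := by
  rw [thetaQuot, one_mul, mul_one]

lemma thetaQuot_one_ne_zero {q : ℝ} (hq0 : 0 < q) (hq1 : q < 1) : thetaQuot q 1 ≠ 0 := by
  rw [thetaQuot_one]
  exact div_ne_zero (pow_ne_zero 2 (thetaProd_neg_one_ne_zero hq0 hq1))
    (pow_ne_zero 2 (thetaProd_neg_ne_zero hq0 hq1))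

lemma rectMap_zero (hL : 0 < L) : rectMap L 0 = 1 := by
  have hq := exp_neg_mem_Ioo hL
  rw [rectMap, Complex.exp_zero, div_self (thetaQuot_one_ne_zero hq.1 hq.2)]

lemma rectMap_pi_mul_I (hL : 0 < L) : rectMap L (π * Complex.I) = 0 := by
  have hq := exp_neg_mem_Ioo hL
  rw [rectMap, Complex.exp_pi_mul_I, thetaQuot, neg_neg,
    thetaProd_one _ (norm_ofReal_sq_lt_one hq.1 hq.2)]
  simp

lemma rectMap_ofReal_self (hL : 0 < L) : rectMap L L = cornerPos L := by
  have hq := exp_neg_mem_Ioo hL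
  have he : Complex.exp L = 1 / (Real.exp (-L) : ℝ) := by
    rw [Complex.ofReal_exp, Complex.ofReal_neg, Complex.exp_neg, one_div, inv_inv]
  rw [rectMap, cornerPos, he]
  set q := Real.exp (-L)
  have hqc : (q : ℂ) ≠ 0 := Complex.ofReal_ne_zero.2 hq.1.ne'
  have h1 := thetaProd_mul (ofReal_sq_ne_zero hq.1) (norm_ofReal_sq_lt_one hq.1 hq.2)
    (neg_ne_zero.2 one_ne_zero)
  rw [mul_neg_one, mul_neg_one, neg_inj] at h1
  have h2 := thetaProd_neg_one_ne_zero hq.1 hq.2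
  have h3 := thetaProd_neg_ne_zero hq.1 hq.2
  -- The corner corresponds to w = 1/q; inversion moves it to w = q, where the shift by q² relates
  -- θ(-q²) to θ(-1).
  rw [thetaQuot_inv hq.1 hq.2 hqc, cornerOfNome_eq hq.1 hq.2, thetaQuot_one, thetaQuot,
    ← pow_two, h1]
  field_simp

lemma rectMap_conj (hL : 0 < L) (z : ℂ) :
    (starRingEnd ℂ) (rectMap L z) =
      thetaQuot (Real.exp (-L)) ((starRingEnd ℂ) (Complex.exp z)) / thetaQuot (Real.exp (-L)) 1 := by
  have hq := exp_neg_mem_Ioo hL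
  rw [rectMap, map_div₀, ← thetaQuot_conj hq.1 hq.2, ← thetaQuot_conj hq.1 hq.2, map_one]

lemma exp_mem_halfAnnulus {z : ℂ} (hz : z ∈ openRect L) :
    Complex.exp z ∈ {w : ℂ | 0 < w.im ∧ 1 < ‖w‖ ∧ Real.exp (-L) * ‖w‖ < 1} := by
  obtain ⟨⟨h1, h2⟩, h3, h4⟩ := mem_openRect.1 hz
  refine ⟨?_, ?_, ?_⟩
  · rw [Complex.exp_im]
    exact mul_pos (Real.exp_pos _) (Real.sin_pos_of_pos_of_lt_pi h3 h4)
  · rw [Complex.norm_exp]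
    exact Real.one_lt_exp_iff.2 h1
  · rw [exp_neg_mul_norm_exp]
    exact Real.exp_lt_one_iff.2 (by linarith)

lemma rectMap_injOn (hL : 0 < L) : InjOn (rectMap L) (openRect L) := by
  have hq := exp_neg_mem_Ioo hL
  intro z hz z' hz' h
  have h1 := thetaQuot_injOn hq.1 hq.2 (exp_mem_halfAnnulus hz) (exp_mem_halfAnnulus hz')
    ((div_left_inj' (thetaQuot_one_ne_zero hq.1 hq.2)).1 h)
  obtain ⟨-, h3, h4⟩ := mem_openRect.1 hz
  obtain ⟨-, h3', h4'⟩ := mem_openRect.1 hz'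
  exact Complex.exp_inj_of_neg_pi_lt_of_le_pi (by linarith [pi_pos]) h4.le
    (by linarith [pi_pos]) h4'.le h1

lemma rectMap_im_ne_zero (hL : 0 < L) {z : ℂ} (hz : z ∈ openRect L) : (rectMap L z).im ≠ 0 := by
  have hq := exp_neg_mem_Ioo hL
  intro h
  have h1 := Complex.conj_eq_iff_im.2 h
  rw [rectMap_conj hL, rectMap, div_left_inj' (thetaQuot_one_ne_zero hq.1 hq.2)] at h1
  obtain ⟨h2, h3, h4⟩ := exp_mem_halfAnnulus hz
  exact thetaQuot_conj_ne hq.1 hq.2 h2 h3 h4 h1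

/-- On each side conjugation of e^z is a symmetry of `thetaQuot`: inversion on the left, inversion
followed by a shift on the right (where z̄ = -z + 2L), and the identity on the horizontal sides,
where e^z is real. -/
lemma rectMap_im_eq_zero (hL : 0 < L) {z : ℂ} (hz : z ∈ closure (openRect L))
    (hz' : z ∉ openRect L) : (rectMap L z).im = 0 := by
  have hq := exp_neg_mem_Ioo hL
  rw [← Complex.conj_eq_iff_im, rectMap_conj hL, rectMap]
  congr 1
  obtain ⟨⟨h1, h2⟩, h3, h4⟩ := (mem_closure_openRect hL).1 hz
  rw [mem_openRect] at hz'
  have hcases : z.re = 0 ∨ z.re = L ∨ z.im = 0 ∨ z.im = π := by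
    by_contra! hne
    exact hz' ⟨⟨h1.lt_of_ne' hne.1, h2.lt_of_ne hne.2.1⟩, h3.lt_of_ne' hne.2.2.1,
      h4.lt_of_ne hne.2.2.2⟩
  rcases hcases with h | h | h | h
  · have hc : (starRingEnd ℂ) z = -z := by apply Complex.ext <;> simp [h]
    rw [← Complex.exp_conj, hc, Complex.exp_neg, ← one_div,
      thetaQuot_inv hq.1 hq.2 (Complex.exp_ne_zero z)]
  · have hc : (starRingEnd ℂ) z = -z + 2 * L := by
      apply Complex.ext
      · simp [h]
        ring
      · simp
    rw [← thetaQuot_mul hq.1 hq.2 (by simp), ← Complex.exp_conj, hc,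
      ← thetaQuot_inv hq.1 hq.2 (Complex.exp_ne_zero z), one_div, ← Complex.exp_neg,
      Complex.ofReal_exp, ← Complex.exp_nat_mul, ← Complex.exp_add]
    congr 2
    push_cast
    ring
  · rw [Complex.conj_eq_iff_im.2]
    simp [Complex.exp_im, h]
  · rw [Complex.conj_eq_iff_im.2]
    simp [Complex.exp_im, h]

lemma ne_corner_of_mem_openRect {z : ℂ} (hz : z ∈ openRect L) : z ≠ L + π * Complex.I := by
  rintro rfl
  simpa using (mem_openRect.1 hz).1.2

lemma rectMap_sendsToInfty (hL : 0 < L) :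
    SendsToInfty (rectMap L) (openRect L) (L + π * Complex.I) := by
  have hq := exp_neg_mem_Ioo hL
  set q := Real.exp (-L) with hqdef
  have hp := norm_ofReal_sq_lt_one hq.1 hq.2
  have hqc : (q : ℂ) ≠ 0 := Complex.ofReal_ne_zero.2 hq.1.ne'
  have he : Complex.exp (L + π * Complex.I) = -(1 / q) := by
    rw [Complex.exp_add, Complex.exp_pi_mul_I, hqdef, Complex.ofReal_exp, Complex.ofReal_neg,
      Complex.exp_neg, one_div, inv_inv]
    ring
  have hexp := Complex.continuous_exp.continuousAt (x := (L + π * Complex.I : ℂ))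
  have hnum : Tendsto (fun z => thetaProd ((q : ℂ) ^ 2) (-Complex.exp z))
      (𝓝 (L + π * Complex.I)) (𝓝 (thetaProd ((q : ℂ) ^ 2) (1 / q))) := by
    have h1 := (differentiableAt_thetaProd hp (one_div_ne_zero hqc)).continuousAt.tendsto
    refine h1.comp ?_
    have := hexp.tendsto.neg
    rwa [he, neg_neg] at this
  have hden : Tendsto (fun z => thetaProd ((q : ℂ) ^ 2) (-(q * Complex.exp z)))
      (𝓝 (L + π * Complex.I)) (𝓝 0) := by
    have h1 := (differentiableAt_thetaProd hp one_ne_zero).continuousAt.tendsto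
    rw [thetaProd_one _ hp] at h1
    refine h1.comp ?_
    have := (hexp.tendsto.const_mul (q : ℂ)).neg
    rwa [he, mul_neg, neg_neg, mul_one_div_cancel hqc] at this
  have hne : thetaProd ((q : ℂ) ^ 2) (1 / q) ≠ 0 := by
    intro h
    have h1 := thetaProd_inv (ofReal_sq_ne_zero hq.1) hp hqc
    rw [h, zero_mul, eq_comm, neg_eq_zero] at h1
    exact thetaProd_self_ne_zero hq.1 hq.2 h1
  -- The reciprocal tends to 0, and it is nonzero inside the rectangle because the map has no real
  -- values there.
  have hinv : Tendsto (fun z => (rectMap L z)⁻¹) (𝓝 (L + π * Complex.I)) (𝓝 0) := by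
    have h := ((hexp.tendsto.mul (hden.pow 2)).div (hnum.pow 2) (pow_ne_zero 2 hne)).mul_const
      (thetaQuot q 1)
    rw [zero_pow two_ne_zero, mul_zero, zero_div, zero_mul] at h
    refine h.congr fun z => ?_
    simp only [Pi.div_apply]
    rw [rectMap, inv_div, ← hqdef, div_eq_mul_inv _ (thetaQuot q (Complex.exp z)), mul_comm,
      thetaQuot.eq_def q (Complex.exp z), inv_div]
  have h2 : Tendsto (fun z => (rectMap L z)⁻¹) (𝓝[openRect L] (L + π * Complex.I)) (𝓝[≠] 0) := by
    refine tendsto_nhdsWithin_iff.2 ⟨hinv.mono_left nhdsWithin_le_nhds, ?_⟩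
    filter_upwards [self_mem_nhdsWithin] with z hz
    exact inv_ne_zero fun h => rectMap_im_ne_zero hL hz (by rw [h, Complex.zero_im])
  have h3 := tendsto_inv₀_nhdsNE_zero.comp h2
  simpa only [SendsToInfty, Function.comp_def, inv_inv] using h3

lemma ofReal_ne_corner (x L : ℝ) : (x : ℂ) ≠ L + π * Complex.I := by
  intro h
  have := congrArg Complex.im h
  simp at this
  exact pi_pos.ne this

/-- The map takes 0 to 1 and L to ρ > 1, so by the mean value theorem its derivative has positive
real part at some point c of the bottom side. By the Cauchy–Riemann equations the imaginary part
then increases when moving up from c. -/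
lemma exists_rectMap_im_pos (hL : 0 < L) : ∃ z ∈ openRect L, 0 < (rectMap L z).im := by
  have hmem : ∀ x ∈ Icc 0 L, (x : ℂ) ∈ closure (openRect L) := fun x hx => by
    simp [mem_closure_openRect hL, hx.1, hx.2, pi_pos.le]
  have hder : ∀ x ∈ Icc 0 L, HasDerivAt (rectMap L) (deriv (rectMap L) x) x := fun x hx =>
    (differentiableAt_rectMap hL (hmem x hx) (ofReal_ne_corner x L)).hasDerivAt
  obtain ⟨c, hc, hslope⟩ := exists_hasDerivAt_eq_slope (fun x : ℝ => (rectMap L x).re)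
    (fun x : ℝ => (deriv (rectMap L) x).re) hL
    (fun x hx => (hder x hx).real_of_complex.continuousAt.continuousWithinAt)
    (fun x hx => (hder x (Ioo_subset_Icc_self hx)).real_of_complex)
  have hpos : 0 < (deriv (rectMap L) c).re := by
    rw [hslope, rectMap_ofReal_self hL, Complex.ofReal_zero, rectMap_zero hL, Complex.ofReal_re,
      Complex.one_re]
    exact div_pos (by linarith [one_lt_cornerPos hL]) (by linarith)
  have hline : HasDerivAt (fun z : ℂ => (c : ℂ) + z * Complex.I) Complex.I ((0 : ℝ) : ℂ) := by
    simpa using ((hasDerivAt_id ((0 : ℝ) : ℂ)).mul_const Complex.I).const_add (c : ℂ)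
  -- Multiplication by -i turns the imaginary part into the real part, to which `real_of_complex`
  -- applies.
  have hcomp : HasDerivAt (fun z : ℂ => -Complex.I * rectMap L (c + z * Complex.I))
      (-Complex.I * (deriv (rectMap L) c * Complex.I)) ((0 : ℝ) : ℂ) := by
    refine HasDerivAt.const_mul _ (HasDerivAt.comp (h₂ := rectMap L)
      (h := fun z : ℂ => (c : ℂ) + z * Complex.I) _ ?_ hline)
    simpa using hder c (Ioo_subset_Icc_self hc)
  have hreal := hcomp.real_of_complex.tendsto_slope_zero_right
  have hval : (-Complex.I * (deriv (rectMap L) c * Complex.I)).re = (deriv (rectMap L) c).re := by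
    simp
  rw [hval] at hreal
  have hc0 : (rectMap L c).im = 0 := rectMap_im_eq_zero hL (hmem c (Ioo_subset_Icc_self hc))
    fun h => by simpa using (mem_openRect.1 h).2.1
  have hev := hreal.eventually_const_lt hpos
  have hnear : Ioo (0 : ℝ) π ∈ 𝓝[>] 0 := Ioo_mem_nhdsGT pi_pos
  obtain ⟨y, hy, hy0, hyπ⟩ := (hev.and hnear).exists
  refine ⟨c + y * Complex.I, ?_, ?_⟩
  · rw [mem_openRect]
    simpa using ⟨hc, hy0, hyπ⟩
  · simp only [zero_add, smul_eq_mul] at hy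
    have := (mul_pos_iff_of_pos_left (inv_pos.2 hy0)).1 hy
    simpa [hc0] using this

lemma rectMap_isConformalOnto (hL : 0 < L) :
    IsConformalOnto (rectMap L) (openRect L) UpperHalfPlane.upperHalfPlaneSet :=
  isConformalOnto_upperHalfPlane (isOpen_openRect L) (isPreconnected_openRect L)
    (isBounded_openRect L)
    (fun _ hz => (differentiableAt_rectMap hL (subset_closure hz)
      (ne_corner_of_mem_openRect hz)).differentiableWithinAt)
    (rectMap_injOn hL) (fun _ hz hc => (differentiableAt_rectMap hL hz hc).continuousAt)
    (rectMap_sendsToInfty hL) (fun _ hz hz' _ => rectMap_im_eq_zero hL hz hz')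
    (fun _ hz => rectMap_im_ne_zero hL hz) (exists_rectMap_im_pos hL)

lemma rectMap_sendsTo (hL : 0 < L) {z : ℂ} (hz : z ∈ closure (openRect L))
    (hc : z ≠ L + π * Complex.I) : SendsTo (rectMap L) (openRect L) z (rectMap L z) :=
  (differentiableAt_rectMap hL hz hc).continuousAt.tendsto.mono_left nhdsWithin_le_nhds

lemma rectMap_sendsTo_zero (hL : 0 < L) :
    SendsTo (rectMap L) (openRect L) (π * Complex.I) 0 := by
  have h := rectMap_sendsTo hL (pi_mul_I_mem_closure_openRect hL) (by simpa using hL.ne')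
  rwa [rectMap_pi_mul_I hL] at h

lemma rectMap_sendsTo_one (hL : 0 < L) : SendsTo (rectMap L) (openRect L) 0 1 := by
  have h := rectMap_sendsTo hL (zero_mem_closure_openRect hL)
    (by simpa using ofReal_ne_corner 0 L)
  rwa [rectMap_zero hL] at h

lemma rectMap_sendsTo_cornerPos (hL : 0 < L) :
    SendsTo (rectMap L) (openRect L) L (cornerPos L) := by
  have h := rectMap_sendsTo hL (ofReal_mem_closure_openRect hL) (ofReal_ne_corner L L)
  rwa [rectMap_ofReal_self hL] at h

lemma isRectMapPhi_rectMap (hL : 0 < L) : IsRectMapPhi L (rectMap L) :=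
  ⟨rectMap_isConformalOnto hL, rectMap_sendsTo_zero hL, rectMap_sendsTo_one hL,
    rectMap_sendsToInfty hL⟩

/-! ### Uniqueness and the second normalization -/

lemma IsRectMapPhi.eqOn (hL : 0 < L) {Φ Φ' : ℂ → ℂ} (h : IsRectMapPhi L Φ)
    (h' : IsRectMapPhi L Φ') : EqOn Φ' Φ (openRect L) :=
  eqOn_of_isConformalOnto (isOpen_openRect L) h.conformal h'.conformal
    (pi_mul_I_mem_closure_openRect hL) (zero_mem_closure_openRect hL)
    (add_pi_mul_I_mem_closure_openRect hL) h.at_top_left h.at_bottom_left h.at_top_right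
    h'.at_top_left h'.at_bottom_left h'.at_top_right

lemma IsRectMapPsi.eqOn (hL : 0 < L) {Ψ Ψ' : ℂ → ℂ} (h : IsRectMapPsi L Ψ)
    (h' : IsRectMapPsi L Ψ') : EqOn Ψ' Ψ (openRect L) :=
  eqOn_of_isConformalOnto (isOpen_openRect L) h.conformal h'.conformal
    (add_pi_mul_I_mem_closure_openRect hL) (zero_mem_closure_openRect hL)
    (ofReal_mem_closure_openRect hL) h.at_top_right h.at_bottom_left h.at_bottom_right
    h'.at_top_right h'.at_bottom_left h'.at_bottom_right

lemma SendsTo.congr {f g : ℂ → ℂ} {D : Set ℂ} {a b : ℂ} (h : SendsTo f D a b) (hfg : EqOn g f D) :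
    SendsTo g D a b :=
  Tendsto.congr' (by filter_upwards [self_mem_nhdsWithin] with z hz using (hfg hz).symm) h

/-- The conformal map of the rectangle with the normalization `0 ↦ 1`, `L ↦ ∞`, `L + iπ ↦ 0`. -/
noncomputable def rectMapPsi (L : ℝ) (z : ℂ) : ℂ := (cornerPos L - 1) / (cornerPos L - rectMap L z)

/-- The Möbius map w ↦ (r - 1)/(r - w) has real coefficients and determinant r - 1 > 0, so it is an
automorphism of the half-plane; the preimage of w is r - (r - 1)/w. -/
lemma isConformalOnto_mobius {D : Set ℂ} {F : ℂ → ℂ} {r : ℝ} (hr : 1 < r)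
    (hF : IsConformalOnto F D UpperHalfPlane.upperHalfPlaneSet) :
    IsConformalOnto (fun z => (r - 1) / (r - F z)) D UpperHalfPlane.upperHalfPlaneSet := by
  have him : ∀ z ∈ D, 0 < (F z).im := fun z hz => hF.2.mapsTo hz
  have hne : ∀ w : ℂ, 0 < w.im → (r : ℂ) - w ≠ 0 := fun w hw h => by
    have := congrArg Complex.im h
    simp at this
    linarith
  have hr1 : (r : ℂ) - 1 ≠ 0 := by
    rw [sub_ne_zero]
    exact_mod_cast hr.ne'
  have hsub : ((r : ℂ) - 1) = ((r - 1 : ℝ) : ℂ) := by push_cast; ring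
  refine ⟨DifferentiableOn.div (by fun_prop) (hF.1.const_sub _) fun z hz => hne _ (him z hz),
    fun z hz => ?_, fun z hz z' hz' h => ?_, fun w hw => ?_⟩
  · change 0 < (((r : ℂ) - 1) / (r - F z)).im
    rw [hsub, div_eq_mul_inv, Complex.im_ofReal_mul, Complex.inv_im]
    refine mul_pos (by linarith) (div_pos ?_ (Complex.normSq_pos.2 (hne _ (him z hz))))
    simpa using him z hz
  · have h1 := (div_eq_div_iff (hne _ (him z hz)) (hne _ (him z' hz'))).1 h
    refine hF.2.injOn hz hz' ?_
    have h2 := mul_left_cancel₀ hr1 h1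
    linear_combination h2
  · have hw' : 0 < w.im := hw
    have hw0 : w ≠ 0 := fun h => by simp [h] at hw'
    have hmem : 0 < ((r : ℂ) - (r - 1) / w).im := by
      rw [hsub, div_eq_mul_inv, Complex.sub_im, Complex.im_ofReal_mul, Complex.inv_im,
        Complex.ofReal_im, neg_div, mul_neg, zero_sub, neg_neg]
      exact mul_pos (by linarith) (div_pos hw' (Complex.normSq_pos.2 hw0))
    obtain ⟨z, hz, hzw⟩ := hF.2.surjOn
      (show (r : ℂ) - (r - 1) / w ∈ UpperHalfPlane.upperHalfPlaneSet from hmem)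
    refine ⟨z, hz, ?_⟩
    change ((r : ℂ) - 1) / (r - F z) = w
    rw [hzw, sub_sub_cancel, div_div_cancel₀ hr1]

lemma isRectMapPsi_rectMapPsi (hL : 0 < L) : IsRectMapPsi L (rectMapPsi L) := by
  have hρ := one_lt_cornerPos hL
  have hr1 : (cornerPos L : ℂ) - 1 ≠ 0 := by
    rw [sub_ne_zero]
    exact_mod_cast hρ.ne'
  have him : ∀ z ∈ openRect L, (cornerPos L : ℂ) - rectMap L z ≠ 0 := fun z hz h => by
    refine rectMap_im_ne_zero hL hz ?_
    rw [← sub_eq_zero.1 h, Complex.ofReal_im]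
  refine ⟨isConformalOnto_mobius hρ (rectMap_isConformalOnto hL), ?_, ?_, ?_⟩
  · have h : SendsTo (rectMapPsi L) (openRect L) 0 ((cornerPos L - 1) / (cornerPos L - 1)) :=
      Tendsto.div tendsto_const_nhds ((rectMap_sendsTo_one hL).const_sub _) hr1
    rwa [div_self hr1] at h
  · have h1 : Tendsto (fun z => (cornerPos L : ℂ) - rectMap L z) (𝓝[openRect L] (L : ℂ))
        (𝓝 ((cornerPos L : ℂ) - cornerPos L)) := (rectMap_sendsTo_cornerPos hL).const_sub _
    rw [sub_self] at h1
    have h2 : Tendsto (fun z => ((cornerPos L : ℂ) - rectMap L z) / (cornerPos L - 1))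
        (𝓝[openRect L] (L : ℂ)) (𝓝[≠] 0) := by
      refine tendsto_nhdsWithin_iff.2 ⟨by simpa using h1.div_const ((cornerPos L : ℂ) - 1), ?_⟩
      filter_upwards [self_mem_nhdsWithin] with z hz
      exact div_ne_zero (him z hz) hr1
    refine (tendsto_inv₀_nhdsNE_zero.comp h2).congr fun z => ?_
    rw [Function.comp_apply, inv_div, rectMapPsi]
  · have h1 : Tendsto (fun z => (cornerPos L : ℂ) - rectMap L z)
        (𝓝[openRect L] (L + π * Complex.I)) (Bornology.cobounded ℂ) := by
      have h := rectMap_sendsToInfty hL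
      rw [SendsToInfty, ← tendsto_norm_atTop_iff_cobounded] at h
      rw [← tendsto_norm_atTop_iff_cobounded]
      refine tendsto_atTop_mono (fun z => ?_) (tendsto_atTop_add_const_right _ (-‖(cornerPos L : ℂ)‖) h)
      rw [norm_sub_rev]
      exact norm_sub_norm_le _ _
    have h2 := (tendsto_inv₀_cobounded.comp h1).const_mul ((cornerPos L : ℂ) - 1)
    rw [mul_zero] at h2
    exact h2

lemma rectMapPsi_sendsTo (hL : 0 < L) :
    SendsTo (rectMapPsi L) (openRect L) (π * Complex.I) ((1 - (cornerPos L)⁻¹ : ℝ) : ℂ) := by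
  have hρ : (cornerPos L : ℂ) ≠ 0 := by exact_mod_cast (zero_lt_one.trans (one_lt_cornerPos hL)).ne'
  have h : SendsTo (rectMapPsi L) (openRect L) (π * Complex.I)
      ((cornerPos L - 1) / (cornerPos L - 0)) :=
    Tendsto.div tendsto_const_nhds ((rectMap_sendsTo_zero hL).const_sub _) (by simpa using hρ)
  have he : ((cornerPos L : ℂ) - 1) / (cornerPos L - 0) = ((1 - (cornerPos L)⁻¹ : ℝ) : ℂ) := by
    push_cast
    field_simp
    ring
  rwa [he] at h

end

theorem mainTheorem11 :
    -- existence and uniqueness of the two normalized conformal maps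
    (∀ L : ℝ, 0 < L →
      (∃ Φ : ℂ → ℂ, IsRectMapPhi L Φ ∧
        ∀ Φ' : ℂ → ℂ, IsRectMapPhi L Φ' → EqOn Φ' Φ (openRect L)) ∧
      (∃ Ψ : ℂ → ℂ, IsRectMapPsi L Ψ ∧
        ∀ Ψ' : ℂ → ℂ, IsRectMapPsi L Ψ' → EqOn Ψ' Ψ (openRect L))) ∧
    -- the maps `Φ`: the image `ρ` of the corner `L`, monotonicity and asymptotics
    (∀ Φ : ℝ → ℂ → ℂ, (∀ L : ℝ, 0 < L → IsRectMapPhi L (Φ L)) →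
      ∃ ρ : ℝ → ℝ,
        (∀ L : ℝ, 0 < L → 1 < ρ L ∧ SendsTo (Φ L) (openRect L) (L : ℂ) (ρ L : ℂ)) ∧
        -- `L` is a strictly increasing function `ℓ` of `ρ ∈ (1, ∞)`
        (∃ ℓ : ℝ → ℝ, StrictMonoOn ℓ (Ioi 1) ∧ MapsTo ℓ (Ioi 1) (Ioi 0) ∧
          InvOn ℓ ρ (Ioi 0) (Ioi 1)) ∧
        (fun L : ℝ => L - Real.log (ρ L)) =O[atTop] (fun _ => (1 : ℝ))) ∧
    -- the maps `Ψ`: the image `ξ` of the corner `iπ` and asymptotics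
    (∀ Ψ : ℝ → ℂ → ℂ, (∀ L : ℝ, 0 < L → IsRectMapPsi L (Ψ L)) →
      ∃ ξ : ℝ → ℝ,
        (∀ L : ℝ, 0 < L → ξ L ∈ Ioo (0 : ℝ) 1 ∧
          SendsTo (Ψ L) (openRect L) (π * Complex.I) (ξ L : ℂ)) ∧
        (fun L : ℝ => L - (-Real.log (1 - ξ L))) =O[atTop] (fun _ => (1 : ℝ))) := by
  refine ⟨fun L hL => ⟨⟨rectMap L, isRectMapPhi_rectMap hL,
      fun _ h => (isRectMapPhi_rectMap hL).eqOn hL h⟩,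
      ⟨rectMapPsi L, isRectMapPsi_rectMapPsi hL,
      fun _ h => (isRectMapPsi_rectMapPsi hL).eqOn hL h⟩⟩,
    fun Φ hΦ => ⟨cornerPos, fun L hL => ⟨one_lt_cornerPos hL, ?_⟩, exists_inverse_cornerPos,
      isBigO_sub_log_cornerPos⟩,
    fun Ψ hΨ => ⟨fun L => 1 - (cornerPos L)⁻¹, fun L hL => ⟨?_, ?_⟩, ?_⟩⟩
  · exact (rectMap_sendsTo_cornerPos hL).congr ((isRectMapPhi_rectMap hL).eqOn hL (hΦ L hL))
  · have h := one_lt_cornerPos hL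
    have h1 := inv_lt_one_of_one_lt₀ h
    have h2 := inv_pos.2 (zero_lt_one.trans h)
    constructor <;> linarith
  · exact (rectMapPsi_sendsTo hL).congr ((isRectMapPsi_rectMapPsi hL).eqOn hL (hΨ L hL))
  -- Since 1 - ξ = 1/ρ, this is the same estimate as for ρ.
  · simpa only [sub_sub_cancel, Real.log_inv, neg_neg] using isBigO_sub_log_cornerPos
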